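/- Let $1\le d\le 3$ and let either (Neumann case) $\Omega\subset\mathbb R^d$ be a bounded domain with $C^1$ boundary, or (periodic case) $\Omega=(0,L)^d$ with $L>0$. Let $\dot H^1$ be $H^1(\Omega)$ in the Neumann case and $H^1_{per}(\Omega)$ in the periodic case, $|v|_1=\|\nabla v\|_{L^2(\Omega)}$, and let $A=-\Delta$ be the self-adjoint operator on $L^2(\Omega)$ with the corresponding boundary condition, i.e. $v\in\mathcal D(A)$, $Av=h\in L^2(\Omega)$ iff $v\in\dot H^1$ and $(\nabla v,\nabla\chi)=(h,\chi)$ for all $\chi\in\dot H^1$. Put $m(v)=\frac1{|\Omega|}\int_\Omega v\,dx$, $\bar v=v-m(v)$ and $|v|_{-1}=\sup_{\chi\in\dot H^1}|(v,\chi)|/|\chi|_1$ (with $0/0=0$). Let $f=F'$ on $\mathbb R$, $F(0)=0$, and let $p\ge 2$ be real ($p=2$ if $d=3$), $c_0>0$, $c_1,c_3\in\mathbb R$ and $c_2:(0,\infty)\to\mathbb R$ be such that for all $v\in\mathbb R$, $\eta>0$ (reading $v^{2p}$ as $|v|^{2p}$) $$f(v)v\ge pc_0v^{2p}-c_1,\qquad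 |f(v)|\le\eta c_0v^{2p}+c_2(\eta),\qquad \tfrac12c_0v^{2p}-c_3\le F(v)\le\tfrac32c_0v^{2p}+c_3 .$$ Let $\varepsilon,c>0$, let $0=t^0<t^1<\cdots$ with $t^n\to\infty$, and let $k_n=t^{n+1}-t^n$, $k=\sup_nk_n$. Let $u^0=u_0\in L^2(\Omega)$ and let $(u^n)$ solve the implicit Euler scheme for the Cahn–Hilliard equation, $$\frac{u^{n+1}-u^n}{k_n}+Aw^{n+1}=0,\qquad w^{n+1}=\varepsilon Au^{n+1}+f(u^{n+1}),\qquad u^{n+1},w^{n+1}\in\mathcal D(A),\quad n\ge0 .$$ **Theorem (Time uniform bound in $H^{-1}$).** There is a constant $\gamma_1>0$ depending only on $\Omega$ and the type of boundary condition such that $|\bar v|_{-1}\le\gamma_1|v|_1$ for all $v\in\dot H^1$. For any such $\gamma_1$ the following holds. Let $k\le 8\varepsilon/c^2$, $|\overline{u_0}|_{-1}\le R$ with $R\ge0$, and $|m(u_0)|\le\alpha$. Put $$\hat\rho_0=\sqrt{2C_1(\alpha)}\Big(\frac{\gamma_1^2}{\varepsilon}+\frac{8\varepsilon}{c^2}\Big)^{1/2},\qquad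 C_1(\alpha)=(c_1+c_2\alpha+2c_3)|\Omega|,\qquad c_2=c_2\Big(\frac{p-3/2}{\alpha}\Big),$$ where $c_2\alpha$ is read as $0$ if $\alpha=0$. Then $$|\overline{u^n}|_{-1}\le\max\{R,\hat\rho_0\}\qquad\text{for all }n\ge0 .$$ Moreover, if $\hat\rho_0>0$, then $$|\overline{u^n}|_{-1}\le2\hat\rho_0\qquad\text{for all }n\ge n_0,$$ where $n_0$ is any index with $t^{n_0}\ge\big(\frac{\gamma_1^2}{\varepsilon}+\frac{8\varepsilon}{c^2}\big)\ln(R^2/\hat\rho_0^2)$ (no condition on $n_0$ if $R=0$); a positive such $n_0$ exists, and it does not depend on $u_0$ beyond $R$ and $\alpha$. -/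

import Mathlib

open MeasureTheory Filter Set
open scoped ContDiff ENNReal

noncomputable section

namespace CahnHilliard

/-- The two types of boundary condition: no flux (Neumann), or periodic with period `L` in every
coordinate direction. -/
inductive BoundaryCondition where
  | neumann : BoundaryCondition
  | periodic (L : ℝ) : BoundaryCondition

/-- `Ω` has a boundary of class `C¹`: near each boundary point, `Ω` is the sublevel set
`{ρ < 0}` of a `C¹` function `ρ` whose differential at that point is not zero. -/
def HasC1Boundary {d : ℕ} (Ω : Set (EuclideanSpace ℝ (Fin d))) : Prop :=
  ∀ x ∈ frontier Ω, ∃ (V : Set (EuclideanSpace ℝ (Fin d))) (ρ : EuclideanSpace ℝ (Fin d) → ℝ),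
    IsOpen V ∧ x ∈ V ∧ ContDiffOn ℝ 1 ρ V ∧ fderiv ℝ ρ x ≠ 0 ∧ Ω ∩ V = {y ∈ V | ρ y < 0}

/-- The spatial domains: a bounded domain with `C¹` boundary in the Neumann case, the open cube
`(0, L)^d` in the periodic case. -/
def BoundaryCondition.Admissible {d : ℕ} (Ω : Set (EuclideanSpace ℝ (Fin d))) :
    BoundaryCondition → Prop
  | .neumann => IsOpen Ω ∧ IsConnected Ω ∧ Bornology.IsBounded Ω ∧ HasC1Boundary Ω
  | .periodic L => 0 < L ∧ Ω = {x | ∀ i, x i ∈ Ioo 0 L}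

/-- Smooth test functions for weak derivatives: compactly supported in `Ω` in the Neumann case,
`L`-periodic in each coordinate in the periodic case. -/
def BoundaryCondition.IsTest {d : ℕ} (Ω : Set (EuclideanSpace ℝ (Fin d)))
    (φ : EuclideanSpace ℝ (Fin d) → ℝ) : BoundaryCondition → Prop
  | .neumann => ContDiff ℝ ∞ φ ∧ HasCompactSupport φ ∧ tsupport φ ⊆ Ω
  | .periodic L => ContDiff ℝ ∞ φ ∧ ∀ x i, φ (x + EuclideanSpace.single i L) = φ x

/-- `v` belongs to the space `Ḣ¹ = D(A^{1/2})`, which is `H¹(Ω)` in the Neumann case and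
`H¹_per(Ω)` in the periodic case, and `g` is its weak gradient. Hence
`|v|₁ = ‖A^{1/2} v‖ = ‖g‖_{L²(Ω)}`. -/
structure IsWeakGradient {d : ℕ} (bc : BoundaryCondition) (Ω : Set (EuclideanSpace ℝ (Fin d)))
    (v : EuclideanSpace ℝ (Fin d) → ℝ)
    (g : EuclideanSpace ℝ (Fin d) → EuclideanSpace ℝ (Fin d)) : Prop where
  memLp : MemLp v 2 (volume.restrict Ω)
  memLp_grad : MemLp g 2 (volume.restrict Ω)
  integral_eq : ∀ φ, bc.IsTest Ω φ → ∀ y,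
    ∫ x in Ω, v x * fderiv ℝ φ x y = -∫ x in Ω, inner ℝ (g x) y * φ x

/-- `v ∈ D(A)` and `A v = h`, where `A = -Δ` is the self-adjoint operator on `L²(Ω)` with the
given boundary condition, i.e. the operator of the form `(∇v, ∇χ)` on `Ḣ¹`. A function of
class `H²` that satisfies the Neumann or the periodic boundary condition lies in `D(A)` by Green's
formula. -/
def IsNegLaplacian {d : ℕ} (bc : BoundaryCondition) (Ω : Set (EuclideanSpace ℝ (Fin d)))
    (v h : EuclideanSpace ℝ (Fin d) → ℝ) : Prop :=
  MemLp h 2 (volume.restrict Ω) ∧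
    ∃ g, IsWeakGradient bc Ω v g ∧ ∀ χ G, IsWeakGradient bc Ω χ G →
      ∫ x in Ω, inner ℝ (g x) (G x) = ∫ x in Ω, h x * χ x

/-- The norm `|v|₋₁ = sup_{χ ∈ Ḣ¹} |(v, χ)| / |χ|₁`, with values in `[0, ∞]` and `0 / 0 = 0`
(it is `∞` if `v` does not have mean zero). -/
def hNegOneNorm {d : ℕ} (bc : BoundaryCondition) (Ω : Set (EuclideanSpace ℝ (Fin d)))
    (v : EuclideanSpace ℝ (Fin d) → ℝ) : ℝ≥0∞ :=
  ⨆ (χ : EuclideanSpace ℝ (Fin d) → ℝ)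
    (G : EuclideanSpace ℝ (Fin d) → EuclideanSpace ℝ (Fin d)) (_ : IsWeakGradient bc Ω χ G),
    ENNReal.ofReal |∫ x in Ω, v x * χ x| / eLpNorm G 2 (volume.restrict Ω)

/-- The average `m(v)` of `v` over `Ω`. -/
def mean {d : ℕ} (Ω : Set (EuclideanSpace ℝ (Fin d))) (v : EuclideanSpace ℝ (Fin d) → ℝ) : ℝ :=
  (volume.real Ω)⁻¹ * ∫ x in Ω, v x

/-- The mean-free part `v - m(v)`. -/
def meanFree {d : ℕ} (Ω : Set (EuclideanSpace ℝ (Fin d))) (v : EuclideanSpace ℝ (Fin d) → ℝ) :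
    EuclideanSpace ℝ (Fin d) → ℝ :=
  fun x => v x - mean Ω v

/-- `γ₁ > 0` is an admissible constant in `|v - m(v)|₋₁ ≤ γ₁ |v|₁`, `v ∈ Ḣ¹`. -/
def IsNegOneConstant {d : ℕ} (bc : BoundaryCondition) (Ω : Set (EuclideanSpace ℝ (Fin d)))
    (γ₁ : ℝ) : Prop :=
  0 < γ₁ ∧ ∀ v g, IsWeakGradient bc Ω v g →
    hNegOneNorm bc Ω (meanFree Ω v) ≤ ENNReal.ofReal γ₁ * eLpNorm g 2 (volume.restrict Ω)

/-- The assumptions on the nonlinearity `f` and its primitive `F` in dimension `d`;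
`|v| ^ (2 * p)` is `v^{2p}`, and `c₂` depends on `η`. -/
structure IsNonlinearity (d : ℕ) (p : ℝ) (f F : ℝ → ℝ) (c₀ c₁ : ℝ) (c₂ : ℝ → ℝ) (c₃ : ℝ) :
    Prop where
  two_le : 2 ≤ p
  eq_two : d = 3 → p = 2
  c₀_pos : 0 < c₀
  lower : ∀ v, p * c₀ * |v| ^ (2 * p) - c₁ ≤ f v * v
  growth : ∀ η, 0 < η → ∀ v, |f v| ≤ η * c₀ * |v| ^ (2 * p) + c₂ η
  primitive : ∀ v, HasDerivAt F (f v) v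
  primitive_zero : F 0 = 0
  primitive_lower : ∀ v, 1 / 2 * c₀ * |v| ^ (2 * p) - c₃ ≤ F v
  primitive_upper : ∀ v, F v ≤ 3 / 2 * c₀ * |v| ^ (2 * p) + c₃

/-- `0 = t⁰ < t¹ < ⋯` is a partition of `[0, ∞)`. -/
structure IsTimeGrid (t : ℕ → ℝ) : Prop where
  zero : t 0 = 0
  strictMono : StrictMono t
  tendsto : Tendsto t atTop atTop

/-- `(uⁿ)` solves the implicit Euler scheme on the grid `t`: with `kₙ = tⁿ⁺¹ - tⁿ`,
`(uⁿ⁺¹ - uⁿ) / kₙ + A wⁿ⁺¹ = 0` and `wⁿ⁺¹ = ε A uⁿ⁺¹ + f(uⁿ⁺¹)`. Here `a` stands for `A uⁿ⁺¹`,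
and `w` for the discrete chemical potential `wⁿ⁺¹`. -/
def IsImplicitEuler {d : ℕ} (bc : BoundaryCondition) (Ω : Set (EuclideanSpace ℝ (Fin d)))
    (ε : ℝ) (f : ℝ → ℝ) (t : ℕ → ℝ) (u : ℕ → EuclideanSpace ℝ (Fin d) → ℝ) : Prop :=
  MemLp (u 0) 2 (volume.restrict Ω) ∧ ∀ n, ∃ a w : EuclideanSpace ℝ (Fin d) → ℝ,
    IsNegLaplacian bc Ω (u (n + 1)) a ∧
    (∀ᵐ x ∂volume.restrict Ω, w x = ε * a x + f (u (n + 1) x)) ∧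
    IsNegLaplacian bc Ω w (fun x => -((u (n + 1) x - u n x) / (t (n + 1) - t n)))

/-- `C₁(α) = (c₁ + c₂ α + 2 c₃) |Ω|`, where `c₂ = c₂(η)` for `η = (p - 3/2) / α`
(for `α = 0` the term `c₂ α` is zero). -/
def C₁ {d : ℕ} (Ω : Set (EuclideanSpace ℝ (Fin d))) (p c₁ : ℝ) (c₂ : ℝ → ℝ) (c₃ α : ℝ) : ℝ :=
  (c₁ + c₂ ((p - 3 / 2) / α) * α + 2 * c₃) * volume.real Ω

/-- The radius `√(2 C₁(α)) (γ₁² / ε + 8 ε / c²)^{1/2}`. -/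
def rhoHat {d : ℕ} (Ω : Set (EuclideanSpace ℝ (Fin d))) (p c₁ : ℝ) (c₂ : ℝ → ℝ)
    (c₃ c ε γ₁ α : ℝ) : ℝ :=
  √(2 * C₁ Ω p c₁ c₂ c₃ α) * √(γ₁ ^ 2 / ε + 8 * ε / c ^ 2)

end CahnHilliard

end

/-! The bound is a discrete Gronwall argument for `y n`, the square of the `H⁻¹` norm of the
mean-free part of `u n`. Testing with the constant `1` shows that the scheme conserves the mean.
Pairing the step with `w` and expanding the square in the dual norm gives `y (n+1) ≤ y n - 2 k (ū,
w)`, with `ū` the mean-free part of `u (n+1)`. Here `(ū, w) = ε |u|₁² + (ū, f(u))`; the first term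
is at least `(ε / γ₁²) y (n+1)`, and the structure of `f` bounds the second below by `-C₁`. With `g
= γ₁² / ε` this reads `y (n+1) (1 + 2k/g) ≤ y n + 2 k C₁` (`euler_step_hNegOneNorm`). Every level `≥
C₁ g` is therefore invariant, and the excess over `C₁ g` decays at least like `exp (-t / (g + K))`
when all steps are at most `K`.

The dual norm is a bare supremum, so `dual_sq_le_sub` replaces `A⁻¹ū` by an approximate maximiser of
`2 ℓ(χ) - B(χ, χ)`; neither completeness nor solvability of the Poisson problem is needed.

The constant `γ₁` comes from a Poincaré inequality. If all segments between two bounded open sets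
lie in `Ω`, integrating the gradient along them controls the oscillation of `v`
(`IsWeakGradient.lintegral_sub_sq_le`, by mollification). Near a `C¹` boundary point such a pair
exists because the defining function decreases along a whole cone of directions. Compactness of the
closure and connectedness of `Ω` glue the local inequalities together. The cube is convex, so there
one pair suffices, once periodic weak gradients are seen to be ordinary ones. -/

noncomputable section

namespace CahnHilliard

/-! ### Differences of a function controlled by line integrals of its gradient -/

section Segments

variable {E : Type*} [NormedAddCommGroup E] [InnerProductSpace ℝ E]
  [MeasurableSpace E] [BorelSpace E]

/-- Cauchy–Schwarz for the measure with density `w`, whose total mass is at most one. -/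
theorem sq_lintegral_mul_le {α : Type*} [MeasurableSpace α] {μ : Measure α} {w f : α → ℝ≥0∞}
    (hw : AEMeasurable w μ) (hf : AEMeasurable f μ) (h1 : ∫⁻ x, w x ∂μ ≤ 1) :
    (∫⁻ x, w x * f x ∂μ) ^ 2 ≤ ∫⁻ x, w x * f x ^ 2 ∂μ := by
  have hf' := hf.mono' (withDensity_absolutelyContinuous μ w)
  have h2 := ENNReal.lintegral_mul_le_Lp_mul_Lq (μ.withDensity w) (p := 2) (q := 2)
    Real.HolderConjugate.two_two (f := f) (g := 1) hf' aemeasurable_const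
  have hone : ∫⁻ a, (1 : α → ℝ≥0∞) a ^ (2 : ℝ) ∂(μ.withDensity w) ≤ 1 := by
    simpa using h1
  have e1 : ∀ F : α → ℝ≥0∞, AEMeasurable F μ →
      ∫⁻ x, F x ∂(μ.withDensity w) = ∫⁻ x, w x * F x ∂μ := fun F hF => by
    rw [lintegral_withDensity_eq_lintegral_mul₀ hw hF]; rfl
  rw [mul_one, e1 f hf, e1 _ (hf.pow_const _)] at h2
  simp only [ENNReal.rpow_two] at h2 hone
  have h3 : ∫⁻ x, w x * f x ∂μ ≤ (∫⁻ x, w x * f x ^ 2 ∂μ) ^ (1 / 2 : ℝ) := by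
    refine h2.trans ?_
    calc _ ≤ (∫⁻ x, w x * f x ^ 2 ∂μ) ^ (1 / 2 : ℝ) * 1 := by
          gcongr
          exact ENNReal.rpow_le_one hone (by norm_num)
      _ = _ := mul_one _
  calc _ ≤ ((∫⁻ x, w x * f x ^ 2 ∂μ) ^ (1 / 2 : ℝ)) ^ 2 := by gcongr
    _ = _ := by
      rw [← ENNReal.rpow_two, ← ENNReal.rpow_mul]; norm_num

/-- The fundamental theorem of calculus along the segment, then Cauchy–Schwarz on `[0, 1]`. The
majorant `I` stands for the mollified squared gradient. -/
theorem sq_enorm_sub_le_lintegral_segment {v : E → ℝ} (hv : ContDiff ℝ 1 v) {I : E → ℝ≥0∞}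
    (hI : Measurable I) {y b : E}
    (h : ∀ s ∈ Icc (0 : ℝ) 1, ∀ e, ‖fderiv ℝ v (b + s • (y - b)) e‖ₑ ^ 2 ≤
      ‖e‖ₑ ^ 2 * I (b + s • (y - b))) :
    ‖v y - v b‖ₑ ^ 2 ≤ ‖y - b‖ₑ ^ 2 * ∫⁻ s in Icc (0 : ℝ) 1, I (b + s • (y - b)) := by
  have hd : ∀ s : ℝ, HasDerivAt (fun s : ℝ => v (b + s • (y - b)))
      (fderiv ℝ v (b + s • (y - b)) (y - b)) s := by
    intro s
    have h1 : HasDerivAt (fun s : ℝ => b + s • (y - b)) (y - b) s := by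
      simpa using ((hasDerivAt_id s).smul_const (y - b)).const_add b
    exact ((hv.differentiable one_ne_zero) _).hasFDerivAt.comp_hasDerivAt s h1
  have hc : Continuous (fun s : ℝ => fderiv ℝ v (b + s • (y - b)) (y - b)) := by
    have := hv.continuous_fderiv one_ne_zero
    fun_prop
  have h2 := intervalIntegral.integral_eq_sub_of_hasDerivAt (a := 0) (b := 1)
    (fun s _ => hd s) (hc.intervalIntegrable _ _)
  simp only [one_smul, zero_smul, add_zero, add_sub_cancel] at h2
  rw [← h2, intervalIntegral.integral_of_le zero_le_one, ← integral_Icc_eq_integral_Ioc]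
  calc _ ≤ (∫⁻ s in Icc (0 : ℝ) 1, 1 * ‖fderiv ℝ v (b + s • (y - b)) (y - b)‖ₑ) ^ 2 := by
        simp only [one_mul]
        gcongr
        exact enorm_integral_le_lintegral_enorm _
    _ ≤ ∫⁻ s in Icc (0 : ℝ) 1, 1 * ‖fderiv ℝ v (b + s • (y - b)) (y - b)‖ₑ ^ 2 :=
        sq_lintegral_mul_le aemeasurable_const hc.measurable.enorm.aemeasurable (by simp)
    _ ≤ ∫⁻ s in Icc (0 : ℝ) 1, ‖y - b‖ₑ ^ 2 * I (b + s • (y - b)) := by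
        simp only [one_mul]
        refine setLIntegral_mono' measurableSet_Icc fun s hs => h s hs _
    _ = _ := by
        rw [lintegral_const_mul]
        exact hI.comp (Continuous.measurable (by fun_prop))

variable [FiniteDimensional ℝ E]

theorem lintegral_comp_smul_add_le {h : E → ℝ≥0∞} (hh : Measurable h) {r : ℝ} (hr : 1 / 2 ≤ r)
    (c : E) : ∫⁻ x, h (r • x + c) ≤ 2 ^ Module.finrank ℝ E * ∫⁻ x, h x := by
  have hr0 : 0 < r := by linarith
  have h1 : ∫⁻ x, h (r • x + c) = ∫⁻ x, h (x + c) ∂(Measure.map (r • ·) volume) :=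
    (lintegral_map (f := fun x => h (x + c)) (hh.comp (measurable_add_const c))
      (measurable_const_smul r)).symm
  rw [h1, Measure.map_addHaar_smul _ hr0.ne', lintegral_smul_measure, lintegral_add_right_eq_self,
    smul_eq_mul]
  gcongr
  rw [abs_of_pos (by positivity), ← inv_pow, ENNReal.ofReal_pow (by positivity)]
  gcongr
  rw [← ENNReal.ofReal_ofNat]
  apply ENNReal.ofReal_le_ofReal
  rw [inv_le_comm₀ hr0 two_pos]
  linarith

/-- For fixed `s` the point `b + s (y - b)` is affine in `b` with ratio `1 - s` and in `y` with
ratio `s`. One of the ratios is at least `1/2`; integrating in that variable first costs a Jacobian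
of at most `2 ^ dim`. -/
theorem lintegral_segment_le {h : E → ℝ≥0∞} (hh : Measurable h) (Y B : Set E) :
    ∫⁻ q, (∫⁻ s in Icc (0 : ℝ) 1, h (q.2 + s • (q.1 - q.2)))
        ∂((volume.restrict Y).prod (volume.restrict B)) ≤
      2 ^ Module.finrank ℝ E * (volume Y + volume B) * ∫⁻ x, h x := by
  have hm : Measurable (fun z : (E × E) × ℝ => h (z.1.2 + z.2 • (z.1.1 - z.1.2))) := by
    apply hh.comp
    exact Continuous.measurable (by fun_prop)
  rw [lintegral_lintegral_swap hm.aemeasurable]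
  have key : ∀ s ∈ Icc (0 : ℝ) 1, ∫⁻ q, h (q.2 + s • (q.1 - q.2))
      ∂((volume.restrict Y).prod (volume.restrict B)) ≤
      2 ^ Module.finrank ℝ E * (volume Y + volume B) * ∫⁻ x, h x := by
    intro s hs
    have hms : Measurable (fun q : E × E => h (q.2 + s • (q.1 - q.2))) := by
      apply hh.comp
      exact Continuous.measurable (by fun_prop)
    rcases le_total s (1 / 2) with h2 | h2
    · rw [lintegral_prod _ hms.aemeasurable]
      calc ∫⁻ y in Y, ∫⁻ b in B, h (b + s • (y - b))
          ≤ ∫⁻ y in Y, 2 ^ Module.finrank ℝ E * ∫⁻ x, h x := by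
            gcongr with y
            refine (setLIntegral_le_lintegral _ _).trans ?_
            refine le_trans (le_of_eq ?_) (lintegral_comp_smul_add_le hh (r := 1 - s)
              (by linarith) (s • y))
            congr 1; ext b; congr 1; module
        _ = 2 ^ Module.finrank ℝ E * volume Y * ∫⁻ x, h x := by
            rw [setLIntegral_const]; ring
        _ ≤ _ := by gcongr; exact le_self_add
    · rw [lintegral_prod_symm _ hms.aemeasurable]
      calc ∫⁻ b in B, ∫⁻ y in Y, h (b + s • (y - b))
          ≤ ∫⁻ b in B, 2 ^ Module.finrank ℝ E * ∫⁻ x, h x := by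
            gcongr with b
            refine (setLIntegral_le_lintegral _ _).trans ?_
            refine le_trans (le_of_eq ?_) (lintegral_comp_smul_add_le hh (r := s)
              (by linarith) ((1 - s) • b))
            congr 1; ext y; congr 1; module
        _ = 2 ^ Module.finrank ℝ E * volume B * ∫⁻ x, h x := by
            rw [setLIntegral_const]; ring
        _ ≤ _ := by gcongr; exact le_add_self
  calc _ ≤ ∫⁻ s in Icc (0 : ℝ) 1, 2 ^ Module.finrank ℝ E * (volume Y + volume B) * ∫⁻ x, h x :=
        setLIntegral_mono measurable_const key
    _ = _ := by simp

end Segments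

/-! ### Transfer of the segment estimate to weak gradients by mollification -/

section Mollification

open scoped Convolution Topology
open ContinuousLinearMap (lsmul)

variable {d : ℕ} {Ω : Set (EuclideanSpace ℝ (Fin d))} {v : EuclideanSpace ℝ (Fin d) → ℝ}
  {g : EuclideanSpace ℝ (Fin d) → EuclideanSpace ℝ (Fin d)}

theorem IsWeakGradient.locallyIntegrable_indicator {bc : BoundaryCondition}
    (h : IsWeakGradient bc Ω v g) (hΩ : MeasurableSet Ω) :
    LocallyIntegrable (Ω.indicator v) volume :=
  ((memLp_indicator_iff_restrict hΩ).2 h.memLp).locallyIntegrable (by norm_num)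

theorem contDiff_mollify (φ : ContDiffBump (0 : EuclideanSpace ℝ (Fin d)))
    (hv : LocallyIntegrable v volume) :
    ContDiff ℝ 1 (φ.normed volume ⋆[lsmul ℝ ℝ, volume] v) :=
  φ.hasCompactSupport_normed.contDiff_convolution_left (n := 1) _ (φ.contDiff_normed) hv

/-- The derivative falls on the kernel, and `x ↦ φ(z - x)` is an admissible test function since its
support lies in the closed ball. The sign of the reflection cancels the sign in the definition of
the weak gradient. -/
theorem IsWeakGradient.fderiv_mollify (h : IsWeakGradient .neumann Ω v g) (hΩ : MeasurableSet Ω)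
    (φ : ContDiffBump (0 : EuclideanSpace ℝ (Fin d))) {z : EuclideanSpace ℝ (Fin d)}
    (hz : Metric.closedBall z φ.rOut ⊆ Ω) (e : EuclideanSpace ℝ (Fin d)) :
    fderiv ℝ (φ.normed volume ⋆[lsmul ℝ ℝ, volume] (Ω.indicator v)) z e =
      ∫ x in Ω, inner ℝ (g x) e * φ.normed volume (z - x) := by
  have hsm : ContDiff ℝ ∞ (φ.normed volume) := φ.contDiff_normed
  have hsm1 : ContDiff ℝ 1 (φ.normed volume) := φ.contDiff_normed
  have hloc := h.locallyIntegrable_indicator hΩ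
  have hd := φ.hasCompactSupport_normed.hasFDerivAt_convolution_left (μ := volume) (lsmul ℝ ℝ)
    hsm1 hloc z
  have hex := (φ.hasCompactSupport_normed (μ := volume)).fderiv ℝ
  have hex := hex.convolutionExists_left (μ := volume) ((lsmul ℝ ℝ).precompL _)
    (hsm1.continuous_fderiv one_ne_zero) hloc z
  rw [hd.fderiv, convolution_def, ContinuousLinearMap.integral_apply hex]
  simp only [ContinuousLinearMap.precompL_apply, ContinuousLinearMap.lsmul_apply, smul_eq_mul]
  rw [← integral_sub_left_eq_self _ volume z]
  simp only [sub_sub_cancel]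
  have htest : BoundaryCondition.neumann.IsTest Ω (fun x => φ.normed volume (z - x)) := by
    refine ⟨hsm.comp (contDiff_const.sub contDiff_id), ?_, ?_⟩
    · exact φ.hasCompactSupport_normed.comp_homeomorph (Homeomorph.subLeft z)
    · refine subset_trans ?_ hz
      refine closure_minimal ?_ Metric.isClosed_closedBall
      intro x hx
      have : z - x ∈ Function.support (φ.normed volume) := hx
      rw [φ.support_normed_eq] at this
      apply Metric.ball_subset_closedBall
      simpa [dist_eq_norm, norm_sub_rev] using this
  have hi := h.integral_eq _ htest e
  have hder : ∀ x, fderiv ℝ (fun x => φ.normed volume (z - x)) x e =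
      -fderiv ℝ (φ.normed volume) (z - x) e := by
    intro x
    have h1 : HasFDerivAt (fun x => z - x) (-ContinuousLinearMap.id ℝ _) x :=
      (hasFDerivAt_id x).const_sub z
    have h2 := ((hsm1.differentiable one_ne_zero) (z - x)).hasFDerivAt.comp x h1
    have h3 := congrArg (· e) h2.fderiv
    simpa [Function.comp_def] using h3
  simp only [hder, mul_neg, integral_neg, neg_inj] at hi
  rw [← hi, ← integral_indicator hΩ]
  congr 1; ext x
  by_cases hx : x ∈ Ω <;> simp [hx, mul_comm]

theorem enorm_fderiv_mollify_sq_le (h : IsWeakGradient .neumann Ω v g) (hΩ : MeasurableSet Ω)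
    (φ : ContDiffBump (0 : EuclideanSpace ℝ (Fin d))) {z : EuclideanSpace ℝ (Fin d)}
    (hz : Metric.closedBall z φ.rOut ⊆ Ω) (e : EuclideanSpace ℝ (Fin d)) :
    ‖fderiv ℝ (φ.normed volume ⋆[lsmul ℝ ℝ, volume] (Ω.indicator v)) z e‖ₑ ^ 2 ≤
      ‖e‖ₑ ^ 2 * ∫⁻ x in Ω, ENNReal.ofReal (φ.normed volume (z - x)) * ‖g x‖ₑ ^ 2 := by
  have hm : Measurable (fun x => ENNReal.ofReal (φ.normed volume (z - x))) :=
    (φ.continuous_normed.comp (continuous_const.sub continuous_id)).measurable.ennreal_ofReal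
  have hg : AEMeasurable (fun x => ‖g x‖ₑ) (volume.restrict Ω) := h.memLp_grad.1.enorm
  have h1 : ∫⁻ x, ENNReal.ofReal (φ.normed volume (z - x)) = 1 := by
    rw [lintegral_sub_left_eq_self (fun x => ENNReal.ofReal (φ.normed volume x)),
      ← ofReal_integral_eq_lintegral_ofReal φ.integrable_normed
      (ae_of_all _ φ.nonneg_normed), φ.integral_normed, ENNReal.ofReal_one]
  calc _ ≤ (∫⁻ x in Ω, ‖e‖ₑ * (ENNReal.ofReal (φ.normed volume (z - x)) * ‖g x‖ₑ)) ^ 2 := by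
        rw [h.fderiv_mollify hΩ φ hz e]
        gcongr
        refine (enorm_integral_le_lintegral_enorm _).trans (lintegral_mono fun x => ?_)
        rw [enorm_mul, Real.enorm_of_nonneg (φ.nonneg_normed _), mul_comm (ENNReal.ofReal _),
          ← mul_assoc, mul_comm ‖e‖ₑ]
        gcongr
        simp only [enorm_eq_nnnorm]
        exact_mod_cast nnnorm_inner_le_nnnorm (𝕜 := ℝ) (g x) e
    _ = ‖e‖ₑ ^ 2 * (∫⁻ x in Ω, ENNReal.ofReal (φ.normed volume (z - x)) * ‖g x‖ₑ) ^ 2 := by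
        rw [lintegral_const_mul' _ _ enorm_ne_top, mul_pow]
    _ ≤ _ := by
        gcongr
        exact sq_lintegral_mul_le hm.aemeasurable hg
          ((setLIntegral_le_lintegral _ _).trans h1.le)

/-- Tonelli, and the unit mass of the kernel. -/
theorem lintegral_mollify_le (hg : AEStronglyMeasurable g (volume.restrict Ω))
    (φ : ContDiffBump (0 : EuclideanSpace ℝ (Fin d))) :
    ∫⁻ z, ∫⁻ x in Ω, ENNReal.ofReal (φ.normed volume (z - x)) * ‖g x‖ₑ ^ 2 =
      ∫⁻ x in Ω, ‖g x‖ₑ ^ 2 := by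
  have hφ : Measurable (fun x => ENNReal.ofReal (φ.normed volume x)) :=
    φ.continuous_normed.measurable.ennreal_ofReal
  rw [lintegral_lintegral_swap]
  · refine lintegral_congr fun x => ?_
    have hφx : Measurable fun z => ENNReal.ofReal (φ.normed volume (z - x)) :=
      hφ.comp (measurable_sub_const x)
    rw [lintegral_mul_const _ hφx,
      lintegral_sub_right_eq_self (fun x => ENNReal.ofReal (φ.normed volume x)),
      ← ofReal_integral_eq_lintegral_ofReal φ.integrable_normed
      (ae_of_all _ φ.nonneg_normed), φ.integral_normed, ENNReal.ofReal_one, one_mul]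
  · exact (hφ.comp (measurable_fst.sub measurable_snd)).aemeasurable.mul
      ((hg.enorm.pow_const 2).comp_quasiMeasurePreserving Measure.quasiMeasurePreserving_snd)

theorem measurable_lintegral_mollify (hg : AEStronglyMeasurable g (volume.restrict Ω))
    (φ : ContDiffBump (0 : EuclideanSpace ℝ (Fin d))) :
    Measurable (fun z => ∫⁻ x in Ω, ENNReal.ofReal (φ.normed volume (z - x)) * ‖g x‖ₑ ^ 2) := by
  have hφ : Measurable (fun x => ENNReal.ofReal (φ.normed volume x)) :=
    φ.continuous_normed.measurable.ennreal_ofReal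
  have : ∀ z, ∫⁻ x in Ω, ENNReal.ofReal (φ.normed volume (z - x)) * ‖g x‖ₑ ^ 2 =
      ∫⁻ x in Ω, ENNReal.ofReal (φ.normed volume (z - x)) * ‖hg.mk g x‖ₑ ^ 2 := fun z =>
    lintegral_congr_ae (hg.ae_eq_mk.mono fun x hx => by simp only [hx])
  simp_rw [this]
  exact Measurable.lintegral_prod_right ((hφ.comp (measurable_fst.sub measurable_snd)).mul
      (((hg.stronglyMeasurable_mk.enorm).comp measurable_snd).pow_const 2))

theorem IsWeakGradient.lintegral_sub_sq_le_of_isCompact (h : IsWeakGradient .neumann Ω v g)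
    (hΩ : IsOpen Ω) {Y B : Set (EuclideanSpace ℝ (Fin d))} (hY : IsCompact Y) (hB : IsCompact B)
    (hYB : ∀ y ∈ Y, ∀ b ∈ B, segment ℝ b y ⊆ Ω) {D : ℝ≥0∞} (hD : ∀ y ∈ Y, ∀ b ∈ B, ‖y - b‖ₑ ≤ D) :
    ∫⁻ q, ‖v q.1 - v q.2‖ₑ ^ 2 ∂((volume.restrict Y).prod (volume.restrict B)) ≤
      D ^ 2 * (2 ^ d * (volume Y + volume B)) * ∫⁻ x in Ω, ‖g x‖ₑ ^ 2 := by
  -- `K` is the union of all the segments. It is compact in `Ω`, so mollification at a small enough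
  -- radius only sees `Ω` along every segment.
  set K := (fun q : (EuclideanSpace ℝ (Fin d) × EuclideanSpace ℝ (Fin d)) × ℝ =>
    q.1.2 + q.2 • (q.1.1 - q.1.2)) '' ((Y ×ˢ B) ×ˢ Icc 0 1)
  have hKc : IsCompact K := ((hY.prod hB).prod isCompact_Icc).image (by fun_prop)
  have hKΩ : K ⊆ Ω := by
    rintro _ ⟨⟨⟨y, b⟩, s⟩, ⟨⟨hy, hb⟩, hs⟩, rfl⟩
    apply hYB y hy b hb
    rw [segment_eq_image']
    exact ⟨s, hs, rfl⟩
  have hKmem : ∀ y ∈ Y, ∀ b ∈ B, ∀ s ∈ Icc (0 : ℝ) 1, b + s • (y - b) ∈ K :=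
    fun y hy b hb s hs => ⟨((y, b), s), ⟨⟨hy, hb⟩, hs⟩, rfl⟩
  clear_value K
  obtain ⟨δ, hδ, hδK⟩ := hKc.exists_cthickening_subset_open hΩ hKΩ
  -- The outer radius is twice the inner one, the bounded ratio required for almost everywhere
  -- convergence of the mollifications.
  let φ : ℕ → ContDiffBump (0 : EuclideanSpace ℝ (Fin d)) := fun n =>
    ⟨δ / (2 * (n + 1)), δ / (n + 1), by positivity, by
      apply div_lt_div_of_pos_left hδ (by positivity); linarith [(n.cast_nonneg : (0 : ℝ) ≤ n)]⟩
  have hφle : ∀ n, (φ n).rOut ≤ δ := fun n => by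
    change δ / (n + 1) ≤ δ
    apply div_le_self hδ.le
    linarith [(n.cast_nonneg : (0 : ℝ) ≤ n)]
  have hφ0 : Tendsto (fun n => (φ n).rOut) atTop (𝓝 0) := by
    have := tendsto_one_div_add_atTop_nhds_zero_nat.const_mul δ
    simpa [φ, div_eq_mul_inv] using this
  have hloc := h.locallyIntegrable_indicator hΩ.measurableSet
  have hae := ContDiffBump.ae_convolution_tendsto_right_of_locallyIntegrable (K := 2) hφ0
    (Eventually.of_forall fun n => by
      change δ / (n + 1) ≤ 2 * (δ / (2 * (n + 1)))
      apply le_of_eq; field_simp) hloc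
  set V : ℕ → EuclideanSpace ℝ (Fin d) → ℝ := fun n =>
    (φ n).normed volume ⋆[lsmul ℝ ℝ, volume] (Ω.indicator v) with hV
  have hYm := hY.measurableSet
  have hBm := hB.measurableSet
  have hbound : ∀ n, ∫⁻ q, ‖V n q.1 - V n q.2‖ₑ ^ 2
      ∂((volume.restrict Y).prod (volume.restrict B)) ≤
      D ^ 2 * (2 ^ d * (volume Y + volume B)) * ∫⁻ x in Ω, ‖g x‖ₑ ^ 2 := by
    intro n
    have hIm := measurable_lintegral_mollify h.memLp_grad.1 (φ n)
    set I : EuclideanSpace ℝ (Fin d) → ℝ≥0∞ := fun z =>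
      ∫⁻ x in Ω, ENNReal.ofReal ((φ n).normed volume (z - x)) * ‖g x‖ₑ ^ 2 with hI
    have hmem : ∀ᵐ q ∂((volume.restrict Y).prod (volume.restrict B)), q ∈ Y ×ˢ B := by
      rw [Measure.prod_restrict]
      exact ae_restrict_mem (hYm.prod hBm)
    calc _ ≤ ∫⁻ q, (D ^ 2 * ∫⁻ s in Icc (0 : ℝ) 1, I (q.2 + s • (q.1 - q.2)))
          ∂((volume.restrict Y).prod (volume.restrict B)) := by
          refine lintegral_mono_ae (hmem.mono ?_)
          rintro ⟨y, b⟩ ⟨hy, hb⟩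
          refine (sq_enorm_sub_le_lintegral_segment (contDiff_mollify _ hloc) hIm
            fun s hs e => enorm_fderiv_mollify_sq_le h hΩ.measurableSet (φ n) ?_ e).trans ?_
          · refine subset_trans ?_ hδK
            refine (Metric.closedBall_subset_closedBall (hφle n)).trans ?_
            exact Metric.closedBall_subset_cthickening (hKmem y hy b hb s hs) δ
          · gcongr
            exact hD y hy b hb
      _ = D ^ 2 * ∫⁻ q, (∫⁻ s in Icc (0 : ℝ) 1, I (q.2 + s • (q.1 - q.2)))
          ∂((volume.restrict Y).prod (volume.restrict B)) := by
          rw [lintegral_const_mul]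
          have : Measurable (fun z : (EuclideanSpace ℝ (Fin d) × EuclideanSpace ℝ (Fin d)) × ℝ =>
            I (z.1.2 + z.2 • (z.1.1 - z.1.2))) := hIm.comp (Continuous.measurable (by fun_prop))
          exact this.lintegral_prod_right'
      _ ≤ D ^ 2 * (2 ^ d * (volume Y + volume B) * ∫⁻ x, I x) := by
          gcongr
          simpa using lintegral_segment_le hIm Y B
      _ = _ := by rw [hI, lintegral_mollify_le h.memLp_grad.1, ← mul_assoc]
  have hmeas : ∀ n, Measurable (fun q : EuclideanSpace ℝ (Fin d) × EuclideanSpace ℝ (Fin d) =>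
      ‖V n q.1 - V n q.2‖ₑ ^ 2) := fun n => by
    have := (contDiff_mollify (φ n) hloc).continuous.measurable
    exact ((this.comp measurable_fst).sub (this.comp measurable_snd)).enorm.pow_const 2
  have hlim : ∀ᵐ q ∂((volume.restrict Y).prod (volume.restrict B)),
      ‖v q.1 - v q.2‖ₑ ^ 2 ≤ liminf (fun n => ‖V n q.1 - V n q.2‖ₑ ^ 2) atTop := by
    have hsub : ∀ y ∈ Y, ∀ b ∈ B, y ∈ Ω ∧ b ∈ Ω := fun y hy b hb =>
      ⟨hYB y hy b hb (right_mem_segment _ _ _), hYB y hy b hb (left_mem_segment _ _ _)⟩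
    have h1 := (Measure.quasiMeasurePreserving_fst (μ := volume.restrict Y)
      (ν := volume.restrict B)).ae (ae_restrict_of_ae (s := Y) hae)
    have h2 := (Measure.quasiMeasurePreserving_snd (μ := volume.restrict Y)
      (ν := volume.restrict B)).ae (ae_restrict_of_ae (s := B) hae)
    have hmem : ∀ᵐ q ∂((volume.restrict Y).prod (volume.restrict B)), q ∈ Y ×ˢ B := by
      rw [Measure.prod_restrict]
      exact ae_restrict_mem (hYm.prod hBm)
    filter_upwards [h1, h2, hmem] with q hq1 hq2 hq3
    obtain ⟨hq4, hq5⟩ := hsub _ hq3.1 _ hq3.2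
    rw [indicator_of_mem hq4] at hq1
    rw [indicator_of_mem hq5] at hq2
    have h3 : Tendsto (fun n => ‖V n q.1 - V n q.2‖ₑ ^ 2) atTop (𝓝 (‖v q.1 - v q.2‖ₑ ^ 2)) :=
      ((ENNReal.continuous_pow 2).tendsto _).comp ((hq1.sub hq2).enorm)
    exact h3.liminf_eq.ge
  -- Fatou's lemma: the bound does not depend on the mollification radius.
  calc _ ≤ ∫⁻ q, liminf (fun n => ‖V n q.1 - V n q.2‖ₑ ^ 2) atTop
        ∂((volume.restrict Y).prod (volume.restrict B)) := lintegral_mono_ae hlim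
    _ ≤ liminf (fun n => ∫⁻ q, ‖V n q.1 - V n q.2‖ₑ ^ 2
        ∂((volume.restrict Y).prod (volume.restrict B))) atTop := lintegral_liminf_le hmeas
    _ ≤ _ := by
      refine (liminf_le_liminf (Eventually.of_forall hbound)).trans ?_
      simp

/-- Bounded open sets are increasing unions of compact sets, and the compact estimate has a constant
that is monotone in the sets. -/
theorem IsWeakGradient.lintegral_sub_sq_le (h : IsWeakGradient .neumann Ω v g)
    (hΩ : IsOpen Ω) {Y B : Set (EuclideanSpace ℝ (Fin d))} (hY : IsOpen Y) (hB : IsOpen B)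
    (hYB : ∀ y ∈ Y, ∀ b ∈ B, segment ℝ b y ⊆ Ω) (hYb : Bornology.IsBounded Y)
    (hBb : Bornology.IsBounded B) {D : ℝ≥0∞} (hD : ∀ y ∈ Y, ∀ b ∈ B, ‖y - b‖ₑ ≤ D) :
    ∫⁻ q, ‖v q.1 - v q.2‖ₑ ^ 2 ∂((volume.restrict Y).prod (volume.restrict B)) ≤
      D ^ 2 * (2 ^ d * (volume Y + volume B)) * ∫⁻ x in Ω, ‖g x‖ₑ ^ 2 := by
  obtain ⟨F, hFc, hFs, hFU, hFm⟩ := hY.exists_iUnion_isClosed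
  obtain ⟨F', hFc', hFs', hFU', hFm'⟩ := hB.exists_iUnion_isClosed
  have hU : Y ×ˢ B = ⋃ n, F n ×ˢ F' n := by
    rw [← hFU, ← hFU', iUnion_prod_of_monotone hFm hFm']
  rw [Measure.prod_restrict, hU, setLIntegral_iUnion_of_directed]
  · refine iSup_le fun n => ?_
    have := h.lintegral_sub_sq_le_of_isCompact hΩ
      (Metric.isCompact_of_isClosed_isBounded (hFc n) (hYb.subset (hFs n)))
      (Metric.isCompact_of_isClosed_isBounded (hFc' n) (hBb.subset (hFs' n)))
      (fun y hy b hb => hYB y (hFs n hy) b (hFs' n hb))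
      (fun y hy b hb => hD y (hFs n hy) b (hFs' n hb))
    rw [Measure.prod_restrict] at this
    refine this.trans ?_
    gcongr
    · exact hFs n
    · exact hFs' n
  · exact Monotone.directed_le fun m n hmn => prod_mono (hFm hmn) (hFm' hmn)

end Mollification

/-! ### Poincaré inequality: local versions, gluing, and the `C¹` boundary -/

section Poincare

open scoped Topology

variable {d : ℕ} {Ω : Set (EuclideanSpace ℝ (Fin d))}

/-- On `Y`, all functions with a weak gradient in `Ω` satisfy a Poincaré inequality against the
`L²(Ω)` norm of the gradient. -/
def PoincareOn (Ω Y : Set (EuclideanSpace ℝ (Fin d))) : Prop :=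
  ∃ C : ℝ≥0∞, C ≠ ⊤ ∧ ∀ v g, IsWeakGradient .neumann Ω v g →
    ∃ c : ℝ, ∫⁻ x in Y, ‖v x - c‖ₑ ^ 2 ≤ C * ∫⁻ x in Ω, ‖g x‖ₑ ^ 2

theorem poincareOn_empty : PoincareOn Ω ∅ := ⟨0, by simp, fun _ _ _ => ⟨0, by simp⟩⟩

theorem poincareOn_of_segment (hΩ : IsOpen Ω) {Y B : Set (EuclideanSpace ℝ (Fin d))}
    (hY : IsOpen Y) (hB : IsOpen B) (hB0 : B.Nonempty)
    (hYB : ∀ y ∈ Y, ∀ b ∈ B, segment ℝ b y ⊆ Ω) (hYb : Bornology.IsBounded Y)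
    (hBb : Bornology.IsBounded B) : PoincareOn Ω Y := by
  rcases Y.eq_empty_or_nonempty with rfl | ⟨y₀, hy₀⟩
  · exact poincareOn_empty
  obtain ⟨b₀, hb₀⟩ := hB0
  obtain ⟨D, hD⟩ := Metric.isBounded_iff.1 (hYb.union hBb)
  have hBvol : volume B ≠ 0 := (hB.measure_pos _ ⟨b₀, hb₀⟩).ne'
  have hBfin : volume B ≠ ⊤ := hBb.measure_lt_top.ne
  have hYfin : volume Y ≠ ⊤ := hYb.measure_lt_top.ne
  refine ⟨(volume B)⁻¹ * (ENNReal.ofReal D ^ 2 * (2 ^ d * (volume Y + volume B))), by finiteness,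
    fun v g h => ?_⟩
  have key := h.lintegral_sub_sq_le hΩ hY hB hYB hYb hBb (D := ENNReal.ofReal D)
    fun y hy b hb => by
      rw [← edist_eq_enorm_sub, edist_dist]
      exact ENNReal.ofReal_le_ofReal (hD (Or.inl hy) (Or.inr hb))
  have hYΩ : Y ⊆ Ω := fun y hy => hYB y hy b₀ hb₀ (right_mem_segment _ _ _)
  have hBΩ : B ⊆ Ω := fun b hb => hYB y₀ hy₀ b hb (left_mem_segment _ _ _)
  have hm : AEMeasurable (fun q : EuclideanSpace ℝ (Fin d) × EuclideanSpace ℝ (Fin d) =>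
      ‖v q.1 - v q.2‖ₑ ^ 2) ((volume.restrict Y).prod (volume.restrict B)) := by
    have h1 : AEMeasurable v (volume.restrict Y) := h.memLp.1.aemeasurable.mono_set hYΩ
    have h2 : AEMeasurable v (volume.restrict B) := h.memLp.1.aemeasurable.mono_set hBΩ
    exact ((h1.comp_fst).sub (h2.comp_snd)).enorm.pow_const 2
  rw [lintegral_prod_symm _ hm] at key
  -- Some `b` in `B` does no worse than the average over `B`; the constant is then `v b`.
  obtain ⟨b, -, hb⟩ := exists_le_setLAverage hBvol hBfin hm.lintegral_prod_left'
  refine ⟨v b, hb.trans ?_⟩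
  rw [setLAverage_eq, ENNReal.div_eq_inv_mul, mul_assoc]
  gcongr

theorem enorm_sub_sq_le (a b c : ℝ) :
    ‖a - b‖ₑ ^ 2 ≤ 2 * (‖c - a‖ₑ ^ 2 + ‖c - b‖ₑ ^ 2) := by
  have h : ∀ x : ℝ, ‖x‖ₑ ^ 2 = ENNReal.ofReal (x ^ 2) := fun x => by
    rw [← ofReal_norm, ← ENNReal.ofReal_pow (norm_nonneg _), Real.norm_eq_abs, sq_abs]
  rw [h, h, h, ← ENNReal.ofReal_add (by positivity) (by positivity), ← ENNReal.ofReal_ofNat,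
    ← ENNReal.ofReal_mul (by positivity)]
  apply ENNReal.ofReal_le_ofReal
  nlinarith [sq_nonneg ((c - a) + (c - b))]

/-- The two constants are comparable because both approximate `v` on the overlap, which is open and
nonempty and so has positive measure. -/
theorem PoincareOn.union (hΩ : volume Ω ≠ ⊤) {Y Z : Set (EuclideanSpace ℝ (Fin d))}
    (hYo : IsOpen Y) (hZo : IsOpen Z) (hYΩ : Y ⊆ Ω) (hZΩ : Z ⊆ Ω) (hYZ : (Y ∩ Z).Nonempty)
    (hY : PoincareOn Ω Y) (hZ : PoincareOn Ω Z) : PoincareOn Ω (Y ∪ Z) := by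
  obtain ⟨C, hC, hY⟩ := hY
  obtain ⟨C', hC', hZ⟩ := hZ
  have hW0 : volume (Y ∩ Z) ≠ 0 := ((hYo.inter hZo).measure_pos _ hYZ).ne'
  have hW : volume (Y ∩ Z) ≠ ⊤ := measure_ne_top_of_subset (inter_subset_left.trans hYΩ) hΩ
  have hZfin : volume Z ≠ ⊤ := measure_ne_top_of_subset hZΩ hΩ
  refine ⟨C + 2 * (2 * (C + C') / volume (Y ∩ Z) * volume Z + C'), by finiteness,
    fun v g h => ?_⟩
  obtain ⟨c, hc⟩ := hY v g h
  obtain ⟨c', hc'⟩ := hZ v g h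
  have hv : ∀ c : ℝ, AEMeasurable (fun x => ‖v x - c‖ₑ ^ 2) (volume.restrict Ω) := fun c =>
    (h.memLp.1.aemeasurable.sub_const c).enorm.pow_const 2
  set G := ∫⁻ x in Ω, ‖g x‖ₑ ^ 2
  have h1 : ‖c - c'‖ₑ ^ 2 * volume (Y ∩ Z) ≤ 2 * (C + C') * G := by
    calc ‖c - c'‖ₑ ^ 2 * volume (Y ∩ Z) = ∫⁻ x in Y ∩ Z, ‖c - c'‖ₑ ^ 2 := by
          rw [setLIntegral_const]
      _ ≤ ∫⁻ x in Y ∩ Z, 2 * (‖v x - c‖ₑ ^ 2 + ‖v x - c'‖ₑ ^ 2) :=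
          lintegral_mono fun x => enorm_sub_sq_le _ _ _
      _ = 2 * ((∫⁻ x in Y ∩ Z, ‖v x - c‖ₑ ^ 2) + ∫⁻ x in Y ∩ Z, ‖v x - c'‖ₑ ^ 2) := by
          rw [lintegral_const_mul' _ _ (by simp), lintegral_add_left']
          exact (hv c).mono_set (inter_subset_left.trans hYΩ)
      _ ≤ 2 * (C * G + C' * G) := by
          gcongr
          · exact (lintegral_mono_set inter_subset_left).trans hc
          · exact (lintegral_mono_set inter_subset_right).trans hc'
      _ = _ := by ring
  have h2 : ‖c - c'‖ₑ ^ 2 ≤ 2 * (C + C') / volume (Y ∩ Z) * G := by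
    rw [← ENNReal.le_div_iff_mul_le (Or.inl hW0) (Or.inl hW)] at h1
    refine h1.trans (le_of_eq ?_)
    simp only [div_eq_mul_inv]; ring
  refine ⟨c, (lintegral_union_le _ _ _).trans ?_⟩
  have h3 : ∫⁻ x in Z, ‖v x - c‖ₑ ^ 2 ≤ 2 * (‖c - c'‖ₑ ^ 2 * volume Z + C' * G) := by
    calc ∫⁻ x in Z, ‖v x - c‖ₑ ^ 2 ≤ ∫⁻ x in Z, 2 * (‖c - c'‖ₑ ^ 2 + ‖v x - c'‖ₑ ^ 2) := by
          refine lintegral_mono fun x => ?_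
          refine (enorm_sub_sq_le (v x) c c').trans (le_of_eq ?_)
          rw [add_comm, enorm_sub_rev c' c, enorm_sub_rev c' (v x)]
      _ = 2 * (‖c - c'‖ₑ ^ 2 * volume Z + ∫⁻ x in Z, ‖v x - c'‖ₑ ^ 2) := by
          rw [lintegral_const_mul' _ _ (by simp), lintegral_add_left' aemeasurable_const,
            setLIntegral_const]
      _ ≤ _ := by gcongr
  calc _ ≤ C * G + 2 * (2 * (C + C') / volume (Y ∩ Z) * G * volume Z + C' * G) := by
        refine add_le_add hc (h3.trans ?_)
        gcongr
    _ = _ := by ring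

theorem poincareOn_of_finite_cover {ι : Type*} (hΩ : IsOpen Ω) (hc : IsConnected Ω)
    (hfin : volume Ω ≠ ⊤) {U : ι → Set (EuclideanSpace ℝ (Fin d))} (s : Finset ι)
    (hU : ∀ i, IsOpen (U i)) (hP : ∀ i ∈ s, PoincareOn Ω (Ω ∩ U i)) (hcov : Ω ⊆ ⋃ i ∈ s, U i) :
    PoincareOn Ω Ω := by
  classical
  set S : Set (Finset ι) := {t | t ⊆ s ∧ (Ω ∩ ⋃ i ∈ t, U i).Nonempty ∧
    PoincareOn Ω (Ω ∩ ⋃ i ∈ t, U i)} with hS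
  have hSfin : S.Finite := (s.powerset.finite_toSet).subset fun t ht => by
    simpa using ht.1
  have hSne : S.Nonempty := by
    obtain ⟨x, hx⟩ := hc.nonempty
    obtain ⟨i, hi, hxi⟩ := mem_iUnion₂.1 (hcov hx)
    exact ⟨{i}, by simpa using hi, ⟨x, hx, by simpa using hxi⟩, by simpa using hP i hi⟩
  -- A maximal subfamily on which the inequality holds must cover `Ω`: otherwise connectedness gives
  -- an unused `U i` that overlaps it inside `Ω`, and gluing contradicts maximality.
  obtain ⟨t, ⟨hts, htne, htP⟩, hmax⟩ := hSfin.exists_maximal hSne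
  have hto : IsOpen (⋃ i ∈ t, U i) := isOpen_biUnion fun i _ => hU i
  by_cases hcase : Ω ⊆ ⋃ i ∈ t, U i
  · rwa [inter_eq_left.2 hcase] at htP
  exfalso
  obtain ⟨x, hxΩ, hxt⟩ := not_subset.1 hcase
  have hex := hc.isPreconnected (⋃ i ∈ t, U i) (⋃ i ∈ s \ t, U i) hto
    (isOpen_biUnion fun i _ => hU i) (fun y hy => by
      obtain ⟨i, hi, hyi⟩ := mem_iUnion₂.1 (hcov hy)
      by_cases hit : i ∈ t
      · exact Or.inl (mem_iUnion₂.2 ⟨i, hit, hyi⟩)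
      · exact Or.inr (mem_iUnion₂.2 ⟨i, Finset.mem_sdiff.2 ⟨hi, hit⟩, hyi⟩)) htne
    (by
      obtain ⟨i, hi, hxi⟩ := mem_iUnion₂.1 (hcov hxΩ)
      exact ⟨x, hxΩ, mem_iUnion₂.2 ⟨i, Finset.mem_sdiff.2
        ⟨hi, fun hit => hxt (mem_iUnion₂.2 ⟨i, hit, hxi⟩)⟩, hxi⟩⟩)
  obtain ⟨y, hyΩ, hyt, hys⟩ := hex
  obtain ⟨i, hi, hyi⟩ := mem_iUnion₂.1 hys
  rw [Finset.mem_sdiff] at hi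
  have hun : Ω ∩ ⋃ j ∈ insert i t, U j = (Ω ∩ U i) ∪ (Ω ∩ ⋃ j ∈ t, U j) := by
    rw [Finset.set_biUnion_insert, inter_union_distrib_left]
  have hmem : insert i t ∈ S := by
    refine ⟨Finset.insert_subset hi.1 hts, ⟨y, hyΩ, ?_⟩, ?_⟩
    · rw [Finset.set_biUnion_insert]
      exact Or.inl hyi
    · rw [hun]
      exact PoincareOn.union hfin (hΩ.inter (hU i)) (hΩ.inter hto) inter_subset_left
        inter_subset_left ⟨y, ⟨hyΩ, hyi⟩, hyΩ, hyt⟩ (hP i hi.1) htP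
  exact hi.2 (hmax hmem (Finset.subset_insert i t) (Finset.mem_insert_self i t))

/-- By continuity of the differential, `ρ` decreases near `x` in every direction close to some `ν`.
Moving from a point of `Ω` near `x` towards a small ball around `x + τ ν` keeps `ρ` negative, so the
whole segment stays in `Ω`. -/
theorem exists_poincareOn_of_boundary (hΩ : IsOpen Ω) {x : EuclideanSpace ℝ (Fin d)}
    {V : Set (EuclideanSpace ℝ (Fin d))} {ρ : EuclideanSpace ℝ (Fin d) → ℝ} (hV : IsOpen V)
    (hx : x ∈ V) (hρ : ContDiffOn ℝ 1 ρ V) (hρx : fderiv ℝ ρ x ≠ 0)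
    (hΩV : Ω ∩ V = {y ∈ V | ρ y < 0}) : ∃ U, IsOpen U ∧ x ∈ U ∧ PoincareOn Ω (Ω ∩ U) := by
  obtain ⟨ν, hν⟩ : ∃ ν, fderiv ℝ ρ x ν < 0 := by
    by_contra! hcon
    apply hρx
    ext e
    refine le_antisymm ?_ (hcon e)
    have := hcon (-e)
    rw [map_neg] at this
    simpa using this
  have hcont : ContinuousAt (fun q : EuclideanSpace ℝ (Fin d) × EuclideanSpace ℝ (Fin d) =>
      fderiv ℝ ρ q.1 q.2) (x, ν) := by
    have h1 : ContinuousAt (fderiv ℝ ρ) x :=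
      (hρ.continuousOn_fderiv_of_isOpen hV le_rfl).continuousAt (hV.mem_nhds hx)
    have h2 : ContinuousAt (fun q : EuclideanSpace ℝ (Fin d) × EuclideanSpace ℝ (Fin d) =>
      fderiv ℝ ρ q.1) (x, ν) := ContinuousAt.comp (f := Prod.fst) h1 continuousAt_fst
    exact h2.clm_apply continuousAt_snd
  have hev := (hcont.eventually_lt_const hν).and
    (continuousAt_fst.eventually (hV.mem_nhds hx) :
      ∀ᶠ q : EuclideanSpace ℝ (Fin d) × EuclideanSpace ℝ (Fin d) in 𝓝 (x, ν), q.1 ∈ V)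
  obtain ⟨σ, hσ, hball⟩ := Metric.eventually_nhds_iff_ball.1 hev
  have hσ' : ∀ y ∈ Metric.ball x σ, y ∈ V ∧ ∀ e ∈ Metric.ball ν σ, fderiv ℝ ρ y e < 0 := by
    intro y hy
    refine ⟨(hball (y, ν) ?_).2, fun e he => (hball (y, e) ?_).1⟩
    · rw [← ball_prod_same]; exact ⟨hy, Metric.mem_ball_self hσ⟩
    · rw [← ball_prod_same]; exact ⟨hy, he⟩
  -- With this `τ` and radii `τ σ / 2`, both balls lie in `ball x σ`, and `b - y` differs from `τ ν`
  -- by less than `τ σ`; after division by `τ` the direction is within `σ` of `ν`.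
  set τ : ℝ := σ / (‖ν‖ + σ + 1) with hτdef
  have hden : 0 < ‖ν‖ + σ + 1 := by positivity
  have hτ : 0 < τ := by positivity
  have hτσ : τ * (‖ν‖ + σ) < σ := by
    rw [hτdef, div_mul_eq_mul_div, div_lt_iff₀ hden]
    nlinarith
  have hν0 := norm_nonneg ν
  have hτν : 0 ≤ τ * ‖ν‖ := by positivity
  have hτσ0 : 0 < τ * σ := by positivity
  refine ⟨Metric.ball x (τ * σ / 2), Metric.isOpen_ball, Metric.mem_ball_self (by positivity), ?_⟩
  refine poincareOn_of_segment hΩ (B := Metric.ball (x + τ • ν) (τ * σ / 2))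
    (hΩ.inter Metric.isOpen_ball) Metric.isOpen_ball ⟨_, Metric.mem_ball_self (by positivity)⟩ ?_
    (Metric.isBounded_ball.subset inter_subset_right) Metric.isBounded_ball
  rintro y ⟨hyΩ, hy⟩ b hb
  have hyx : y ∈ Metric.ball x σ := Metric.ball_subset_ball (by nlinarith) hy
  have hbx : b ∈ Metric.ball x σ := by
    rw [mem_ball_iff_norm] at hb ⊢
    calc ‖b - x‖ = ‖(b - (x + τ • ν)) + τ • ν‖ := by congr 1; module
      _ ≤ ‖b - (x + τ • ν)‖ + ‖τ • ν‖ := norm_add_le _ _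
      _ < σ := by rw [norm_smul, Real.norm_of_nonneg hτ.le]; nlinarith
  have hdir : τ⁻¹ • (b - y) ∈ Metric.ball ν σ := by
    rw [mem_ball_iff_norm] at hb hy ⊢
    calc ‖τ⁻¹ • (b - y) - ν‖ = ‖τ⁻¹ • ((b - (x + τ • ν)) - (y - x))‖ := by
          congr 1
          rw [show b - (x + τ • ν) - (y - x) = (b - y) - τ • ν by module, smul_sub _ _ (τ • ν),
            smul_smul, inv_mul_cancel₀ hτ.ne', one_smul]
      _ ≤ τ⁻¹ * (‖b - (x + τ • ν)‖ + ‖y - x‖) := by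
          rw [norm_smul, Real.norm_of_nonneg (by positivity)]
          gcongr
          exact norm_sub_le _ _
      _ < τ⁻¹ * (τ * σ) := by gcongr; linarith
      _ = σ := by field_simp
  have hseg : ∀ s ∈ Icc (0 : ℝ) 1, y + s • (b - y) ∈ Metric.ball x σ := fun s hs =>
    (convex_ball x σ).add_smul_sub_mem hyx hbx hs
  have hder : ∀ s ∈ Icc (0 : ℝ) 1, HasDerivAt (fun s : ℝ => ρ (y + s • (b - y)))
      (fderiv ℝ ρ (y + s • (b - y)) (b - y)) s := fun s hs => by
    have h1 : HasDerivAt (fun s : ℝ => y + s • (b - y)) (b - y) s := by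
      simpa using ((hasDerivAt_id s).smul_const (b - y)).const_add y
    have h2 : DifferentiableAt ℝ ρ (y + s • (b - y)) :=
      (hρ.differentiableOn one_ne_zero).differentiableAt (hV.mem_nhds (hσ' _ (hseg s hs)).1)
    exact h2.hasFDerivAt.comp_hasDerivAt s h1
  have hanti : AntitoneOn (fun s : ℝ => ρ (y + s • (b - y))) (Icc 0 1) := by
    apply antitoneOn_of_deriv_nonpos (convex_Icc 0 1)
    · exact fun s hs => (hder s hs).continuousAt.continuousWithinAt
    · exact fun s hs => (hder s (interior_subset hs)).differentiableAt.differentiableWithinAt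
    · intro s hs
      rw [(hder s (interior_subset hs)).deriv]
      have := (hσ' _ (hseg s (interior_subset hs))).2 _ hdir
      rw [map_smul, smul_eq_mul] at this
      by_contra! hcon
      exact absurd this (not_lt.2 (by positivity))
  rw [segment_symm, segment_eq_image']
  rintro _ ⟨s, hs, rfl⟩
  have hle := hanti (left_mem_Icc.2 zero_le_one) hs hs.1
  have hyV : y ∈ {y ∈ V | ρ y < 0} := hΩV ▸ ⟨hyΩ, (hσ' y hyx).1⟩
  simp only [zero_smul, add_zero] at hle
  have hfin : y + s • (b - y) ∈ {y ∈ V | ρ y < 0} :=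
    ⟨(hσ' _ (hseg s hs)).1, hle.trans_lt hyV.2⟩
  rw [← hΩV] at hfin
  exact hfin.1

theorem poincareOn_of_convex (hΩ : IsOpen Ω) (hc : Convex ℝ Ω) (hb : Bornology.IsBounded Ω) :
    PoincareOn Ω Ω := by
  rcases Ω.eq_empty_or_nonempty with rfl | hne
  · exact poincareOn_empty
  exact poincareOn_of_segment hΩ hΩ hΩ hne (fun y hy b hb' => hc.segment_subset hb' hy) hb hb

theorem poincareOn_of_hasC1Boundary (hΩ : IsOpen Ω) (hc : IsConnected Ω)
    (hb : Bornology.IsBounded Ω) (hC1 : HasC1Boundary Ω) : PoincareOn Ω Ω := by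
  have hloc : ∀ x ∈ closure Ω, ∃ U, IsOpen U ∧ x ∈ U ∧ PoincareOn Ω (Ω ∩ U) := by
    intro x hx
    by_cases hxΩ : x ∈ Ω
    · obtain ⟨r, hr, hball⟩ := Metric.isOpen_iff.1 hΩ x hxΩ
      refine ⟨Metric.ball x r, Metric.isOpen_ball, Metric.mem_ball_self hr, ?_⟩
      rw [inter_eq_right.2 hball]
      exact poincareOn_of_segment hΩ Metric.isOpen_ball Metric.isOpen_ball
        ⟨x, Metric.mem_ball_self hr⟩
        (fun y hy b hb' => ((convex_ball x r).segment_subset hb' hy).trans hball)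
        Metric.isBounded_ball Metric.isBounded_ball
    · obtain ⟨V, ρ, hV, hxV, hρ, hρx, hΩV⟩ := hC1 x ⟨hx, by rwa [hΩ.interior_eq]⟩
      exact exists_poincareOn_of_boundary hΩ hV hxV hρ hρx hΩV
  choose! U hU hxU hP using hloc
  have hK : IsCompact (closure Ω) := hb.isCompact_closure
  obtain ⟨t, ht⟩ := hK.elim_finite_subcover (fun x : closure Ω => U x)
    (fun x => hU x x.2) (fun x hx => mem_iUnion.2 ⟨⟨x, hx⟩, hxU x hx⟩)
  exact poincareOn_of_finite_cover hΩ hc hb.measure_lt_top.ne t (fun x => hU x x.2)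
    (fun x _ => hP x x.2) (subset_closure.trans ht)

end Poincare

/-! ### Admissible domains, and reduction of the periodic case -/

section Domain

open scoped Topology

variable {d : ℕ} {Ω : Set (EuclideanSpace ℝ (Fin d))}

theorem cube_eq_preimage (d : ℕ) (L : ℝ) : {x : EuclideanSpace ℝ (Fin d) | ∀ i, x i ∈ Ioo 0 L} =
    (WithLp.ofLp : EuclideanSpace ℝ (Fin d) → (Fin d → ℝ)) ⁻¹' (univ.pi fun _ => Ioo 0 L) := by
  ext x; simp

theorem isOpen_cube (d : ℕ) (L : ℝ) :
    IsOpen {x : EuclideanSpace ℝ (Fin d) | ∀ i, x i ∈ Ioo 0 L} := by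
  rw [cube_eq_preimage]
  exact (isOpen_set_pi finite_univ fun _ _ => isOpen_Ioo).preimage (PiLp.continuous_ofLp 2 _)

theorem isBounded_cube (d : ℕ) (L : ℝ) :
    Bornology.IsBounded {x : EuclideanSpace ℝ (Fin d) | ∀ i, x i ∈ Ioo 0 L} := by
  rw [cube_eq_preimage]
  exact (PiLp.antilipschitzWith_ofLp 2 (fun _ : Fin d => ℝ)).isBounded_preimage
    (Bornology.IsBounded.pi fun _ => Metric.isBounded_Ioo 0 L)

theorem convex_cube (d : ℕ) (L : ℝ) :
    Convex ℝ {x : EuclideanSpace ℝ (Fin d) | ∀ i, x i ∈ Ioo 0 L} := by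
  rw [cube_eq_preimage]
  exact (convex_pi fun _ _ => convex_Ioo 0 L).linear_preimage
    (WithLp.linearEquiv 2 ℝ (Fin d → ℝ)).toLinearMap

theorem BoundaryCondition.Admissible.isOpen {bc : BoundaryCondition} (h : bc.Admissible Ω) :
    IsOpen Ω := by
  cases bc with
  | neumann => exact h.1
  | periodic L => rw [h.2]; exact isOpen_cube d L

theorem BoundaryCondition.Admissible.isBounded {bc : BoundaryCondition} (h : bc.Admissible Ω) :
    Bornology.IsBounded Ω := by
  cases bc with
  | neumann => exact h.2.2.1
  | periodic L => rw [h.2]; exact isBounded_cube d L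

theorem BoundaryCondition.Admissible.nonempty {bc : BoundaryCondition} (h : bc.Admissible Ω) :
    Ω.Nonempty := by
  cases bc with
  | neumann => exact h.2.1.nonempty
  | periodic L =>
    rw [h.2]
    exact ⟨WithLp.toLp 2 fun _ => L / 2, fun i => ⟨half_pos h.1, half_lt_self h.1⟩⟩

theorem BoundaryCondition.Admissible.volume_ne_top {bc : BoundaryCondition}
    (h : bc.Admissible Ω) : volume Ω ≠ ⊤ := h.isBounded.measure_lt_top.ne

theorem BoundaryCondition.Admissible.volume_real_pos {bc : BoundaryCondition}
    (h : bc.Admissible Ω) : 0 < volume.real Ω :=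
  ENNReal.toReal_pos (h.isOpen.measure_pos _ h.nonempty).ne' h.volume_ne_top

theorem BoundaryCondition.IsTest.contDiff {bc : BoundaryCondition}
    {φ : EuclideanSpace ℝ (Fin d) → ℝ} (h : bc.IsTest Ω φ) : ContDiff ℝ ∞ φ := by
  cases bc with
  | neumann => exact h.1
  | periodic L => exact h.1

/-- The lattice vector with integer coordinates `k`, scaled by `L`. -/
def latticeVec (L : ℝ) (k : Fin d → ℤ) : EuclideanSpace ℝ (Fin d) :=
  WithLp.toLp 2 fun i => L * k i

/-- The `L`-periodic function obtained by summing all lattice translates of `φ`. -/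
def periodize (L : ℝ) (φ : EuclideanSpace ℝ (Fin d) → ℝ) (x : EuclideanSpace ℝ (Fin d)) : ℝ :=
  ∑ᶠ k : Fin d → ℤ, φ (x + latticeVec L k)

theorem periodize_add_single (L : ℝ) (φ : EuclideanSpace ℝ (Fin d) → ℝ)
    (x : EuclideanSpace ℝ (Fin d)) (i : Fin d) :
    periodize L φ (x + EuclideanSpace.single i L) = periodize L φ x := by
  unfold periodize
  rw [← finsum_comp_equiv (Equiv.addRight (Pi.single i 1))
    (f := fun k => φ (x + latticeVec L k))]
  refine finsum_congr fun k => ?_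
  congr 1
  ext j
  by_cases hj : j = i
  · subst hj; simp [latticeVec]; ring
  · simp [latticeVec, hj]

theorem contDiff_periodize {L : ℝ} (hL : 0 < L) {φ : EuclideanSpace ℝ (Fin d) → ℝ}
    (hφ : ContDiff ℝ ∞ φ) (hsupp : tsupport φ ⊆ {x | ∀ i, x i ∈ Ioo 0 L}) :
    ContDiff ℝ ∞ (periodize L φ) := by
  rw [contDiff_iff_contDiffAt]
  intro x₀
  -- On the unit ball around `x₀`, a lattice shift with a coordinate of modulus at least `N` leaves
  -- the cube, so only finitely many translates contribute.
  obtain ⟨N, hN⟩ := exists_nat_gt ((‖x₀‖ + 1 + L) / L)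
  rw [div_lt_iff₀ hL] at hN
  set s : Finset (Fin d → ℤ) := Fintype.piFinset fun _ => Finset.Icc (-(N : ℤ)) N
  have hev : periodize L φ =ᶠ[𝓝 x₀] fun x => ∑ k ∈ s, φ (x + latticeVec L k) := by
    filter_upwards [Metric.ball_mem_nhds x₀ one_pos] with x hx
    refine finsum_eq_sum_of_support_subset _ fun k hk => ?_
    have hk' := hsupp (subset_tsupport _ hk)
    simp only [s, Finset.mem_coe, Fintype.mem_piFinset, Finset.mem_Icc]
    intro i
    have hi : x i + L * k i ∈ Ioo 0 L := hk' i
    have hxi : |x i| < ‖x₀‖ + 1 := by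
      rw [mem_ball_iff_norm] at hx
      calc |x i| ≤ ‖x‖ := PiLp.norm_apply_le x i
        _ = ‖x₀ + (x - x₀)‖ := by congr 1; abel
        _ ≤ ‖x₀‖ + ‖x - x₀‖ := norm_add_le _ _
        _ < _ := by linarith
    rw [abs_lt] at hxi
    constructor
    · have : (-(N : ℝ)) < k i := by
        by_contra! hcon
        nlinarith [hi.1, hi.2]
      exact_mod_cast this.le
    · have : (k i : ℝ) < N := by
        by_contra! hcon
        nlinarith [hi.1, hi.2]
      exact_mod_cast this.le
  refine ContDiffAt.congr_of_eventuallyEq ?_ hev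
  exact ContDiffAt.sum fun k _ => (hφ.comp (contDiff_id.add contDiff_const)).contDiffAt

/-- Two points of the open cube cannot differ by a nonzero lattice vector. -/
theorem periodize_eqOn {L : ℝ} (hL : 0 < L) {φ : EuclideanSpace ℝ (Fin d) → ℝ}
    (hsupp : tsupport φ ⊆ {x | ∀ i, x i ∈ Ioo 0 L}) :
    EqOn (periodize L φ) φ {x | ∀ i, x i ∈ Ioo 0 L} := by
  intro x hx
  have h0 : φ x = φ (x + latticeVec L 0) := by
    congr 1; ext i; simp [latticeVec]
  rw [h0, periodize]
  refine finsum_eq_single _ 0 fun k hk => ?_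
  by_contra hne
  apply hk
  ext i
  have hi : x i + L * k i ∈ Ioo 0 L := hsupp (subset_tsupport _ hne) i
  have hxi : x i ∈ Ioo 0 L := hx i
  have h1 : (-1 : ℝ) < k i := by
    by_contra! hcon
    nlinarith [hi.1, hi.2, hxi.1, hxi.2]
  have h2 : (k i : ℝ) < 1 := by
    by_contra! hcon
    nlinarith [hi.1, hi.2, hxi.1, hxi.2]
  have h1' : (-1 : ℤ) < k i := by exact_mod_cast h1
  have h2' : k i < (1 : ℤ) := by exact_mod_cast h2
  simp only [Pi.zero_apply]
  lia

/-- A test function supported in the cube extends to a periodic one that agrees with it on the cube,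
so the periodic identity contains the Neumann one. -/
theorem IsWeakGradient.toNeumann {bc : BoundaryCondition} (hΩ : bc.Admissible Ω)
    {v : EuclideanSpace ℝ (Fin d) → ℝ} {g : EuclideanSpace ℝ (Fin d) → EuclideanSpace ℝ (Fin d)}
    (h : IsWeakGradient bc Ω v g) : IsWeakGradient .neumann Ω v g := by
  cases bc with
  | neumann => exact h
  | periodic L =>
    refine ⟨h.memLp, h.memLp_grad, fun φ hφ y => ?_⟩
    have hopen := hΩ.isOpen
    obtain ⟨hL, rfl⟩ := hΩ
    have heq := periodize_eqOn hL hφ.2.2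
    have hint := h.integral_eq (periodize L φ)
      ⟨contDiff_periodize hL hφ.1 hφ.2.2, periodize_add_single L φ⟩ y
    have hm := hopen.measurableSet
    have h1 : ∫ x in {x | ∀ i, x i ∈ Ioo 0 L}, v x * fderiv ℝ (periodize L φ) x y =
        ∫ x in {x | ∀ i, x i ∈ Ioo 0 L}, v x * fderiv ℝ φ x y :=
      setIntegral_congr_fun hm fun x hx => by
        have := (heq.eventuallyEq_of_mem (hopen.mem_nhds hx)).fderiv_eq (𝕜 := ℝ)
        simp only [this]
    have h2 : ∫ x in {x | ∀ i, x i ∈ Ioo 0 L}, inner ℝ (g x) y * periodize L φ x =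
        ∫ x in {x | ∀ i, x i ∈ Ioo 0 L}, inner ℝ (g x) y * φ x :=
      setIntegral_congr_fun hm fun x hx => by
        have := heq hx
        simp only [this]
    rw [h1, h2] at hint
    exact hint

theorem setIntegral_fderiv_eq_zero_of_tsupport_subset {φ : EuclideanSpace ℝ (Fin d) → ℝ}
    (hφ : ContDiff ℝ ∞ φ) (hc : HasCompactSupport φ) (hsupp : tsupport φ ⊆ Ω)
    (y : EuclideanSpace ℝ (Fin d)) : ∫ x in Ω, fderiv ℝ φ x y = 0 := by
  have hcd : Continuous (fun x => fderiv ℝ φ x y) :=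
    (hφ.continuous_fderiv (by simp)).clm_apply continuous_const
  have hcs : HasCompactSupport (fun x => fderiv ℝ φ x y) := hc.fderiv_apply ℝ y
  rw [setIntegral_eq_integral_of_forall_compl_eq_zero fun x hx => by
    have : x ∉ tsupport (fun x => fderiv ℝ φ x y) := fun h =>
      hx (hsupp (tsupport_fderiv_apply_subset ℝ y h))
    exact image_eq_zero_of_notMem_tsupport (f := fun x => fderiv ℝ φ x y) this]
  have := integral_mul_fderiv_eq_neg_fderiv_mul_of_integrable (μ := volume) (f := fun _ => (1 : ℝ))
    (g := φ) (v := y) (by simp) (by simpa using hcd.integrable_of_hasCompactSupport hcs)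
    (by simpa using hφ.continuous.integrable_of_hasCompactSupport hc)
    (fun x _ => by fun_prop) (fun x _ => (hφ.differentiable (by simp)) x)
  simpa using this

/-- Divergence theorem for the field `φ y`: periodicity makes the fluxes through opposite faces
cancel. -/
theorem setIntegral_cube_fderiv_eq_zero {n : ℕ} {L : ℝ} (hL : 0 < L)
    {φ : EuclideanSpace ℝ (Fin (n + 1)) → ℝ} (hφ : ContDiff ℝ ∞ φ)
    (hper : ∀ x i, φ (x + EuclideanSpace.single i L) = φ x)
    (y : EuclideanSpace ℝ (Fin (n + 1))) :
    ∫ x in {x : EuclideanSpace ℝ (Fin (n + 1)) | ∀ i, x i ∈ Ioo 0 L}, fderiv ℝ φ x y = 0 := by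
  have hmp := EuclideanSpace.volume_preserving_symm_measurableEquiv_toLp (Fin (n + 1))
  rw [cube_eq_preimage]
  have hme : MeasurableEmbedding (WithLp.ofLp : EuclideanSpace ℝ (Fin (n + 1)) → _) :=
    (MeasurableEquiv.toLp 2 (Fin (n + 1) → ℝ)).symm.measurableEmbedding
  have h1 := hmp.setIntegral_preimage_emb hme
    (fun z : Fin (n + 1) → ℝ => fderiv ℝ φ (WithLp.toLp 2 z) y) (univ.pi fun _ => Ioo 0 L)
  refine h1.trans ?_
  have hae : (univ.pi fun _ : Fin (n + 1) => Ioo (0 : ℝ) L) =ᵐ[volume]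
      Icc (fun _ => 0) (fun _ => L) := by
    rw [volume_pi]
    exact Measure.univ_pi_Ioo_ae_eq_Icc
  rw [setIntegral_congr_set hae]
  set T : (Fin (n + 1) → ℝ) →L[ℝ] EuclideanSpace ℝ (Fin (n + 1)) :=
    ((EuclideanSpace.equiv (Fin (n + 1)) ℝ).symm).toContinuousLinearMap with hT
  have hd : ∀ z, HasFDerivAt (fun z : Fin (n + 1) → ℝ => φ (WithLp.toLp 2 z))
      ((fderiv ℝ φ (WithLp.toLp 2 z)).comp T) z := fun z =>
    HasFDerivAt.comp z (g := φ) (((hφ.differentiable (by simp)) (T z)).hasFDerivAt) T.hasFDerivAt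
  have hcont : Continuous (fun z : Fin (n + 1) → ℝ => φ (WithLp.toLp 2 z)) :=
    hφ.continuous.comp T.continuous
  have hcd : Continuous (fun z : Fin (n + 1) → ℝ => fderiv ℝ φ (WithLp.toLp 2 z) y) :=
    ((hφ.continuous_fderiv (by simp)).comp T.continuous).clm_apply continuous_const
  have hsum : ∀ z : Fin (n + 1) → ℝ, ∑ i, (y i • (fderiv ℝ φ (WithLp.toLp 2 z)).comp T)
      (Pi.single i 1) = fderiv ℝ φ (WithLp.toLp 2 z) y := by
    intro z
    have hy : y = T (∑ i, y i • Pi.single i (1 : ℝ)) := by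
      ext j
      simp [hT, Finset.sum_apply, Pi.single_apply]
    conv_rhs => rw [hy]
    simp
  have hdiv := integral_divergence_of_hasFDerivAt_off_countable' (a := fun _ : Fin (n + 1) => (0 : ℝ))
    (b := fun _ => L) (fun _ => hL.le) (fun i z => y i • φ (WithLp.toLp 2 z))
    (fun i z => y i • (fderiv ℝ φ (WithLp.toLp 2 z)).comp T) ∅ countable_empty
    (fun i => (hcont.const_smul (y i)).continuousOn)
    (fun z _ i => (hd z).const_smul (y i))
    (by simp_rw [hsum]; exact hcd.integrableOn_Icc)
  simp_rw [hsum] at hdiv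
  rw [hdiv]
  refine Finset.sum_eq_zero fun i _ => ?_
  rw [sub_eq_zero]
  congr 1
  ext z
  congr 1
  rw [← hper (WithLp.toLp 2 (i.insertNth 0 z)) i]
  congr 1
  ext j
  refine Fin.succAboveCases i ?_ (fun j => ?_) j <;> simp

theorem setIntegral_fderiv_eq_zero {bc : BoundaryCondition} (hd : 1 ≤ d) (hΩ : bc.Admissible Ω)
    {φ : EuclideanSpace ℝ (Fin d) → ℝ} (hφ : bc.IsTest Ω φ) (y : EuclideanSpace ℝ (Fin d)) :
    ∫ x in Ω, fderiv ℝ φ x y = 0 := by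
  cases bc with
  | neumann => exact setIntegral_fderiv_eq_zero_of_tsupport_subset hφ.1 hφ.2.1 hφ.2.2 y
  | periodic L =>
    obtain ⟨n, rfl⟩ := Nat.exists_eq_add_of_le' hd
    obtain ⟨hL, rfl⟩ := hΩ
    exact setIntegral_cube_fderiv_eq_zero hL hφ.1 hφ.2 y

/-- Makes constants admissible test functions, which yields conservation of the mean and allows
testing with `u - m(u)`. -/
theorem isWeakGradient_const {bc : BoundaryCondition} (hd : 1 ≤ d) (hΩ : bc.Admissible Ω)
    (c : ℝ) : IsWeakGradient bc Ω (fun _ => c) (fun _ => 0) := by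
  have : IsFiniteMeasure (volume.restrict Ω) := ⟨by simpa using hΩ.volume_ne_top.lt_top⟩
  refine ⟨memLp_const c, memLp_const 0, fun φ hφ y => ?_⟩
  rw [integral_const_mul, setIntegral_fderiv_eq_zero hd hΩ hφ]
  simp

theorem BoundaryCondition.Admissible.poincareOn {bc : BoundaryCondition} (h : bc.Admissible Ω) :
    PoincareOn Ω Ω := by
  cases bc with
  | neumann => exact poincareOn_of_hasC1Boundary h.1 h.2.1 h.2.2.1 h.2.2.2
  | periodic L =>
    refine poincareOn_of_convex h.isOpen ?_ h.isBounded
    rw [h.2]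
    exact convex_cube d L

end Domain

/-! ### Existence of the constant `γ₁` -/

section NegOneConstant

variable {d : ℕ} {Ω : Set (EuclideanSpace ℝ (Fin d))}

theorem ofReal_abs_integral_mul_le {α : Type*} [MeasurableSpace α] {μ : Measure α} {f g : α → ℝ}
    (hf : MemLp f 2 μ) (hg : MemLp g 2 μ) :
    ENNReal.ofReal |∫ x, f x * g x ∂μ| ≤ eLpNorm f 2 μ * eLpNorm g 2 μ := by
  rw [← Real.norm_eq_abs, ofReal_norm]
  refine (enorm_integral_le_lintegral_enorm _).trans ?_
  rw [← eLpNorm_one_eq_lintegral_enorm]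
  exact eLpNorm_smul_le_mul_eLpNorm (φ := f) (p := 2) (q := 2) (r := 1) hg.1 hf.1

/-- The covariance of `v` and `χ` is unchanged when constants are subtracted. Leaving `c` and `c'`
free means the Poincaré constants need not be the means. -/
theorem integral_meanFree_mul {v χ : EuclideanSpace ℝ (Fin d) → ℝ}
    (hΩ : volume.real Ω ≠ 0) (hfin : volume Ω ≠ ⊤) (hv : MemLp v 2 (volume.restrict Ω))
    (hχ : MemLp χ 2 (volume.restrict Ω)) (c c' : ℝ) :
    ∫ x in Ω, meanFree Ω v x * χ x = (∫ x in Ω, (v x - c) * (χ x - c')) -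
      (volume.real Ω)⁻¹ * ((∫ x in Ω, (v x - c) * 1) * ∫ x in Ω, (χ x - c') * 1) := by
  have : IsFiniteMeasure (volume.restrict Ω) := ⟨by simpa using hfin.lt_top⟩
  have hvi := hv.integrable one_le_two
  have hχi := hχ.integrable one_le_two
  have hvχ : Integrable (fun x => v x * χ x) (volume.restrict Ω) := hv.integrable_mul hχ
  have e1 : ∫ x in Ω, meanFree Ω v x * χ x =
      (∫ x in Ω, v x * χ x) - mean Ω v * ∫ x in Ω, χ x := by
    simp only [meanFree, sub_mul]
    rw [integral_sub hvχ (hχi.const_mul _), integral_const_mul]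
  have e2 : ∫ x in Ω, (v x - c) * (χ x - c') = (∫ x in Ω, v x * χ x) - c' * (∫ x in Ω, v x) -
      c * (∫ x in Ω, χ x) + c * c' * volume.real Ω := by
    have : ∀ x, (v x - c) * (χ x - c') = v x * χ x - c' * v x - c * χ x + c * c' := fun x => by
      ring
    simp only [this]
    have i1 := hvi.const_mul c'
    have i2 := hχi.const_mul c
    have i3 : Integrable (fun x => v x * χ x - c' * v x) (volume.restrict Ω) := hvχ.sub i1
    have i4 : Integrable (fun x => v x * χ x - c' * v x - c * χ x) (volume.restrict Ω) := i3.sub i2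
    rw [integral_add i4 (integrable_const _), integral_sub i3 i2, integral_sub hvχ i1,
      integral_const_mul, integral_const_mul]
    simp [mul_comm]
  have e3 : ∀ (u : EuclideanSpace ℝ (Fin d) → ℝ) (a : ℝ), Integrable u (volume.restrict Ω) →
      ∫ x in Ω, (u x - a) * 1 = (∫ x in Ω, u x) - a * volume.real Ω := fun u a hu => by
    simp only [mul_one]
    rw [integral_sub hu (integrable_const _)]
    simp [mul_comm]
  rw [e1, e2, e3 v c hvi, e3 χ c' hχi, mean]
  field_simp
  ring

theorem exists_isNegOneConstant {bc : BoundaryCondition} (hΩ : bc.Admissible Ω) :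
    ∃ γ, IsNegOneConstant bc Ω γ := by
  obtain ⟨C, hC, hP⟩ := hΩ.poincareOn
  have : IsFiniteMeasure (volume.restrict Ω) := ⟨by simpa using hΩ.volume_ne_top.lt_top⟩
  set μ := volume.restrict Ω with hμ
  have hP' : ∀ v g, IsWeakGradient bc Ω v g → ∃ c : ℝ,
      eLpNorm (fun x => v x - c) 2 μ ≤ C ^ (1 / 2 : ℝ) * eLpNorm g 2 μ := by
    intro v g h
    obtain ⟨c, hc⟩ := hP v g (h.toNeumann hΩ)
    refine ⟨c, ?_⟩
    rw [eLpNorm_eq_lintegral_rpow_enorm_toReal two_ne_zero ENNReal.ofNat_ne_top,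
      eLpNorm_eq_lintegral_rpow_enorm_toReal two_ne_zero ENNReal.ofNat_ne_top,
      ENNReal.toReal_ofNat, ← ENNReal.mul_rpow_of_nonneg _ _ (by norm_num)]
    simp only [ENNReal.rpow_two]
    gcongr
  set W : ENNReal := eLpNorm (fun _ : EuclideanSpace ℝ (Fin d) => (1 : ℝ)) 2 μ with hW
  have hWfin : W ≠ ⊤ := (memLp_const (1 : ℝ)).2.ne
  set V : ENNReal := ENNReal.ofReal (volume.real Ω)⁻¹ with hV
  -- The first two terms come from Cauchy–Schwarz on the covariance formula; the summand `1` makes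
  -- the constant strictly positive.
  set K : ENNReal := C + V * W ^ 2 * C + 1 with hK
  have hKfin : K ≠ ⊤ := by finiteness
  have hK0 : K ≠ 0 := by simp [hK]
  refine ⟨K.toReal, ENNReal.toReal_pos hK0 hKfin, fun v g h => ?_⟩
  rw [ENNReal.ofReal_toReal hKfin]
  refine iSup_le fun χ => iSup_le fun G => iSup_le fun hG => ENNReal.div_le_of_le_mul ?_
  obtain ⟨c, hc⟩ := hP' v g h
  obtain ⟨c', hc'⟩ := hP' χ G hG
  rw [integral_meanFree_mul hΩ.volume_real_pos.ne' hΩ.volume_ne_top h.memLp hG.memLp c c']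
  have hv : MemLp (fun x => v x - c) 2 μ := h.memLp.sub (memLp_const c)
  have hχ : MemLp (fun x => χ x - c') 2 μ := hG.memLp.sub (memLp_const c')
  have h1 : MemLp (fun _ : EuclideanSpace ℝ (Fin d) => (1 : ℝ)) 2 μ := memLp_const 1
  have hVpos : 0 < (volume.real Ω)⁻¹ := inv_pos.2 hΩ.volume_real_pos
  have hCC : C ^ (1 / 2 : ℝ) * C ^ (1 / 2 : ℝ) = C := by
    rw [← ENNReal.rpow_add_of_nonneg _ _ (by norm_num) (by norm_num)]; norm_num
  set N := eLpNorm g 2 μ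
  set N' := eLpNorm G 2 μ
  calc _ ≤ ENNReal.ofReal |∫ x in Ω, (v x - c) * (χ x - c')| + V *
        (ENNReal.ofReal |∫ x in Ω, (v x - c) * 1| * ENNReal.ofReal |∫ x in Ω, (χ x - c') * 1|) := by
        rw [hV, ← ENNReal.ofReal_mul (abs_nonneg _), ← ENNReal.ofReal_mul hVpos.le,
          ← ENNReal.ofReal_add (abs_nonneg _) (by positivity)]
        apply ENNReal.ofReal_le_ofReal
        refine (abs_sub _ _).trans (le_of_eq ?_)
        rw [abs_mul, abs_mul, abs_of_pos hVpos]
    _ ≤ (C ^ (1 / 2 : ℝ) * N) * (C ^ (1 / 2 : ℝ) * N') + V *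
        (((C ^ (1 / 2 : ℝ) * N) * W) * ((C ^ (1 / 2 : ℝ) * N') * W)) := by
        gcongr
        · exact (ofReal_abs_integral_mul_le hv hχ).trans (by gcongr)
        · exact (ofReal_abs_integral_mul_le hv h1).trans (by gcongr)
        · exact (ofReal_abs_integral_mul_le hχ h1).trans (by gcongr)
    _ = (C ^ (1 / 2 : ℝ) * C ^ (1 / 2 : ℝ) + V * W ^ 2 * (C ^ (1 / 2 : ℝ) * C ^ (1 / 2 : ℝ))) *
        (N * N') := by ring
    _ ≤ K * (N * N') := by rw [hCC]; gcongr; exact le_self_add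
    _ = _ := by rw [mul_assoc]

end NegOneConstant

/-! ### Dual seminorms of a positive semidefinite form -/

section Duality

/-- Optimise at `s = t / b`; for `b = 0` a linear function of `s` is bounded above only if `t = 0`.
-/
theorem sq_le_mul_of_forall_two_mul_sub_le {t b S : ℝ} (hb : 0 ≤ b)
    (h : ∀ s : ℝ, 2 * s * t - s ^ 2 * b ≤ S) : t ^ 2 ≤ S * b := by
  rcases hb.eq_or_lt with rfl | hb
  · by_contra! hcon
    have ht : t ≠ 0 := by
      rintro rfl
      simp at hcon
    have := h ((S + 1) / (2 * t))
    have e : 2 * ((S + 1) / (2 * t)) * t = S + 1 := by field_simp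
    linarith
  · have := h (t / b)
    have e : 2 * (t / b) * t - (t / b) ^ 2 * b = t ^ 2 / b := by field_simp; ring
    rwa [e, div_le_iff₀ hb] at this

/-- The inequality `|ℓ₁|² ≤ |ℓ₀|² - 2 k ℓ₁(w)` for the dual seminorm of a positive semidefinite form
`B`, if `ℓ₁ - ℓ₀ = -k B(w, ·)`. -/
theorem dual_sq_le_sub {V : Type*} [AddCommGroup V] [Module ℝ V] (ℓ₀ ℓ₁ : V →ₗ[ℝ] ℝ)
    (B : V →ₗ[ℝ] V →ₗ[ℝ] ℝ) (hsymm : ∀ x y, B x y = B y x) (hpos : ∀ x, 0 ≤ B x x)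
    {k Q M : ℝ} (hk : 0 ≤ k) (hQ : 0 ≤ Q) (hM : 0 ≤ M) (w : V)
    (hw : ∀ χ, ℓ₁ χ - ℓ₀ χ = -k * B w χ) (h₀ : ∀ χ, ℓ₀ χ ^ 2 ≤ Q * B χ χ)
    (h₁ : ∀ χ, ℓ₁ χ ^ 2 ≤ M * B χ χ) :
    0 ≤ Q - 2 * k * ℓ₁ w ∧ ∀ χ, ℓ₁ χ ^ 2 ≤ (Q - 2 * k * ℓ₁ w) * B χ χ := by
  have young : ∀ {x b A : ℝ}, 0 ≤ A → 0 ≤ b → x ^ 2 ≤ A * b → 2 * x - b ≤ A := by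
    intro x b A hA hb h
    have : 2 * x ≤ A + b := by
      apply le_of_abs_le
      apply abs_le_of_sq_le_sq _ (by positivity)
      nlinarith [sq_nonneg (A - b)]
    linarith
  -- The supremum `S` of `J` is the squared dual seminorm of `ℓ₁`, and a maximiser would represent
  -- `ℓ₁` through `B`.
  set J : V → ℝ := fun χ => 2 * ℓ₁ χ - B χ χ with hJ
  have hbdd : BddAbove (range J) := ⟨M, by
    rintro _ ⟨χ, rfl⟩
    exact young hM (hpos χ) (h₁ χ)⟩
  set S := sSup (range J) with hS
  have hle : ∀ χ, J χ ≤ S := fun χ => le_csSup hbdd ⟨χ, rfl⟩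
  have hS0 : 0 ≤ S := by simpa [hJ] using hle 0
  have hJadd : ∀ χ ψ (s : ℝ), J (χ + s • ψ) =
      J χ + (2 * s * (ℓ₁ ψ - B ψ χ) - s ^ 2 * B ψ ψ) := by
    intro χ ψ s
    simp only [hJ, map_add, map_smul, LinearMap.add_apply, LinearMap.smul_apply, smul_eq_mul,
      hsymm χ ψ]
    ring
  have hdual : ∀ χ, ℓ₁ χ ^ 2 ≤ S * B χ χ := fun χ =>
    sq_le_mul_of_forall_two_mul_sub_le (hpos χ) fun s => by
      have := hle (0 + s • χ)
      rw [hJadd] at this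
      simpa [hJ] using this
  have hmain : S ≤ Q - 2 * k * ℓ₁ w := by
    have hη : ∀ η : ℝ, 0 < η → S ≤ Q - 2 * k * ℓ₁ w + (η ^ 2 + 2 * k * (η * √(B w w))) := by
      intro η hη
      obtain ⟨_, ⟨χ, rfl⟩, hχ⟩ := exists_lt_of_lt_csSup (range_nonempty J)
        (show S - η ^ 2 < sSup (range J) by rw [← hS]; nlinarith)
      -- `χ` is maximal up to `η²`, so varying it along `w` gains at most `η²`: the Euler–Lagrange
      -- equation holds up to a small error.
      have ht : (ℓ₁ w - B w χ) ^ 2 ≤ η ^ 2 * B w w :=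
        sq_le_mul_of_forall_two_mul_sub_le (hpos w) fun s => by
          have := hle (χ + s • w)
          rw [hJadd] at this
          linarith
      have ht' : ℓ₁ w - B w χ ≤ η * √(B w w) := by
        apply le_of_abs_le
        apply abs_le_of_sq_le_sq _ (by positivity)
        rwa [mul_pow, Real.sq_sqrt (hpos w)]
      have hJ0 : 2 * ℓ₀ χ - B χ χ ≤ Q := young hQ (hpos χ) (h₀ χ)
      have hJχ : J χ = 2 * ℓ₀ χ - B χ χ + 2 * (-k * B w χ) := by rw [← hw]; simp only [hJ]; ring
      nlinarith [mul_le_mul_of_nonneg_left ht' hk]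
    by_contra! hcon
    have hb := Real.sqrt_nonneg (B w w)
    set c := 1 + 2 * k * √(B w w) with hc
    have hcpos : 0 < c := by positivity
    set δ := S - (Q - 2 * k * ℓ₁ w) with hδ
    have hδpos : 0 < δ := by linarith
    -- This `η` makes the error at most `δ / 2`, half of the supposed gap.
    have hm := hη (min 1 (δ / (2 * c))) (by positivity)
    set η := min 1 (δ / (2 * c))
    have h1 : η ≤ 1 := min_le_left _ _
    have h2 : η ≤ δ / (2 * c) := min_le_right _ _
    have hη0 : 0 < η := by positivity
    have h3 : η * c ≤ δ / 2 := by
      calc η * c ≤ δ / (2 * c) * c := by gcongr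
        _ = δ / 2 := by field_simp
    have h4 : η ^ 2 ≤ η := by nlinarith
    have h5 : η * c = η + 2 * k * (η * √(B w w)) := by rw [hc]; ring
    linarith
  refine ⟨hS0.trans hmain, fun χ => (hdual χ).trans ?_⟩
  gcongr
  exact hpos χ

end Duality

/-! ### Discrete Gronwall inequalities -/

section Recursion

variable {y t : ℕ → ℝ} {g K C : ℝ}

theorem le_of_euler_recursion (hg : 0 < g) (ht : ∀ n, 0 ≤ t (n + 1) - t n)
    (h : ∀ n, y (n + 1) * (1 + 2 * (t (n + 1) - t n) / g) ≤ y n + 2 * (t (n + 1) - t n) * C)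
    {M : ℝ} (h0 : y 0 ≤ M) (hM : C * g ≤ M) (n : ℕ) : y n ≤ M := by
  induction n with
  | zero => exact h0
  | succ n ih =>
    have hpos : 0 < 1 + 2 * (t (n + 1) - t n) / g := by have := ht n; positivity
    refine le_of_mul_le_mul_right ?_ hpos
    refine (h n).trans ?_
    have h1 : C ≤ M / g := by rwa [le_div_iff₀ hg]
    calc y n + 2 * (t (n + 1) - t n) * C ≤ M + 2 * (t (n + 1) - t n) * (M / g) := by
          gcongr
          linarith [ht n]
      _ = _ := by ring

/-- Follows from `exp x ≤ 1 / (1 - x)` at `x = k / (g + K)`. The factor `2` leaves the slack `2 (g +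
K) - g - 2 k`, nonnegative because `k ≤ K`. -/
theorem exp_div_add_le {g K k : ℝ} (hg : 0 < g) (hk : 0 ≤ k) (hkK : k ≤ K) :
    Real.exp (k / (g + K)) ≤ 1 + 2 * k / g := by
  have hT : 0 < g + K := by linarith
  have h1 := Real.one_sub_le_exp_neg (k / (g + K))
  have h2 : 0 < 1 - k / (g + K) := by
    rw [sub_pos, div_lt_one hT]; linarith
  have h3 : Real.exp (k / (g + K)) ≤ (1 - k / (g + K))⁻¹ := by
    rw [← inv_inv (Real.exp _), ← Real.exp_neg]
    gcongr
  refine h3.trans ?_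
  rw [inv_le_comm₀ h2 (by positivity), inv_le_iff_one_le_mul₀ (by positivity)]
  have : (1 - k / (g + K)) * (1 + 2 * k / g) =
      1 + k * (2 * (g + K) - g - 2 * k) / (g * (g + K)) := by field_simp; ring
  rw [this]
  have : 0 ≤ k * (2 * (g + K) - g - 2 * k) / (g * (g + K)) := by
    have : 0 ≤ 2 * (g + K) - g - 2 * k := by linarith
    positivity
  linarith

theorem le_exp_of_euler_recursion (hg : 0 < g) (ht0 : t 0 = 0) (ht : ∀ n, 0 ≤ t (n + 1) - t n)
    (htK : ∀ n, t (n + 1) - t n ≤ K)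
    (h : ∀ n, y (n + 1) * (1 + 2 * (t (n + 1) - t n) / g) ≤ y n + 2 * (t (n + 1) - t n) * C)
    {M : ℝ} (hM : 0 ≤ M) (hC : 0 ≤ C) (h0 : y 0 ≤ M) (n : ℕ) :
    y n ≤ C * g + M * Real.exp (-(t n / (g + K))) := by
  induction n with
  | zero =>
    simp only [ht0, zero_div, neg_zero, Real.exp_zero, mul_one]
    nlinarith
  | succ n ih =>
    have hpos : 0 < 1 + 2 * (t (n + 1) - t n) / g := by have := ht n; positivity
    refine le_of_mul_le_mul_right ?_ hpos
    refine (h n).trans ?_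
    have hexp := exp_div_add_le hg (ht n) (htK n)
    have e1 : Real.exp (-(t n / (g + K))) =
        Real.exp (-(t (n + 1) / (g + K))) * Real.exp ((t (n + 1) - t n) / (g + K)) := by
      rw [← Real.exp_add]; congr 1; ring
    -- `C g` is the fixed point of the recursion, so it reproduces itself exactly, and only the
    -- exponential term uses the preceding inequality.
    calc y n + 2 * (t (n + 1) - t n) * C
        ≤ C * g + M * (Real.exp (-(t (n + 1) / (g + K))) *
          Real.exp ((t (n + 1) - t n) / (g + K))) + 2 * (t (n + 1) - t n) * C := by
          rw [← e1]; linarith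
      _ ≤ C * g + M * (Real.exp (-(t (n + 1) / (g + K))) *
          (1 + 2 * (t (n + 1) - t n) / g)) + 2 * (t (n + 1) - t n) * C := by
          gcongr
      _ = _ := by field_simp; ring

end Recursion

/-! ### The space `Ḣ¹` as a vector space with its Dirichlet form -/

section EnergySpace

variable {d : ℕ} {bc : BoundaryCondition} {Ω : Set (EuclideanSpace ℝ (Fin d))}

theorem integrable_mul_fderiv (hΩ : Bornology.IsBounded Ω) {v φ : EuclideanSpace ℝ (Fin d) → ℝ}
    (hv : Integrable v (volume.restrict Ω)) (hφ : ContDiff ℝ ∞ φ)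
    (y : EuclideanSpace ℝ (Fin d)) (hm : MeasurableSet Ω) :
    Integrable (fun x => v x * fderiv ℝ φ x y) (volume.restrict Ω) := by
  have hc : Continuous (fun x => fderiv ℝ φ x y) :=
    (hφ.continuous_fderiv (by simp)).clm_apply continuous_const
  obtain ⟨C, hC⟩ := hΩ.isCompact_closure.exists_bound_of_continuousOn hc.continuousOn
  exact hv.mul_bdd hc.aestronglyMeasurable
    (ae_restrict_of_forall_mem hm fun x hx => hC x (subset_closure hx))

theorem integrable_inner_mul (hΩ : Bornology.IsBounded Ω)
    {g : EuclideanSpace ℝ (Fin d) → EuclideanSpace ℝ (Fin d)} {φ : EuclideanSpace ℝ (Fin d) → ℝ}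
    (hg : Integrable g (volume.restrict Ω)) (hφ : ContDiff ℝ ∞ φ)
    (y : EuclideanSpace ℝ (Fin d)) (hm : MeasurableSet Ω) :
    Integrable (fun x => inner ℝ (g x) y * φ x) (volume.restrict Ω) := by
  obtain ⟨C, hC⟩ := hΩ.isCompact_closure.exists_bound_of_continuousOn hφ.continuous.continuousOn
  exact (hg.inner_const y).mul_bdd hφ.continuous.aestronglyMeasurable
    (ae_restrict_of_forall_mem hm fun x hx => hC x (subset_closure hx))

/-- The vector space of the pairs of a function and a weak gradient of it. -/
def weakGradients (hΩ : bc.Admissible Ω) :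
    Submodule ℝ ((EuclideanSpace ℝ (Fin d) → ℝ) ×
      (EuclideanSpace ℝ (Fin d) → EuclideanSpace ℝ (Fin d))) where
  carrier := {q | IsWeakGradient bc Ω q.1 q.2}
  zero_mem' := ⟨MemLp.zero, MemLp.zero, fun φ _ y => by simp⟩
  add_mem' := by
    rintro ⟨v, g⟩ ⟨w, h⟩ hv hw
    have : IsFiniteMeasure (volume.restrict Ω) := ⟨by simpa using hΩ.volume_ne_top.lt_top⟩
    have hb := hΩ.isBounded
    have hm := hΩ.isOpen.measurableSet
    refine ⟨hv.memLp.add hw.memLp, hv.memLp_grad.add hw.memLp_grad, fun φ hφ y => ?_⟩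
    have h1 := integrable_mul_fderiv hb (hv.memLp.integrable one_le_two) hφ.contDiff y hm
    have h2 := integrable_mul_fderiv hb (hw.memLp.integrable one_le_two) hφ.contDiff y hm
    have h3 := integrable_inner_mul hb (hv.memLp_grad.integrable one_le_two) hφ.contDiff y hm
    have h4 := integrable_inner_mul hb (hw.memLp_grad.integrable one_le_two) hφ.contDiff y hm
    simp only [Prod.mk_add_mk, Pi.add_apply, add_mul, inner_add_left]
    rw [integral_add h1 h2, integral_add h3 h4, hv.integral_eq φ hφ y, hw.integral_eq φ hφ y]
    ring
  smul_mem' := by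
    rintro c ⟨v, g⟩ hv
    refine ⟨hv.memLp.const_smul c, hv.memLp_grad.const_smul c, fun φ hφ y => ?_⟩
    simp only [Prod.smul_mk, Pi.smul_apply, smul_eq_mul, inner_smul_left, mul_assoc,
      integral_const_mul, conj_trivial]
    rw [hv.integral_eq φ hφ y]
    ring

theorem IsWeakGradient.sub_const (hd : 1 ≤ d) (hΩ : bc.Admissible Ω)
    {v : EuclideanSpace ℝ (Fin d) → ℝ} {g : EuclideanSpace ℝ (Fin d) → EuclideanSpace ℝ (Fin d)}
    (h : IsWeakGradient bc Ω v g) (c : ℝ) : IsWeakGradient bc Ω (fun x => v x - c) g := by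
  have h1 : (v, g) ∈ weakGradients hΩ := h
  have h2 : (fun _ => c, fun _ => 0) ∈ weakGradients hΩ := isWeakGradient_const hd hΩ c
  have := (weakGradients hΩ).sub_mem h1 h2
  rwa [show (v, g) - (fun _ => c, fun _ => 0) = (fun x => v x - c, g) from
    Prod.ext rfl (sub_zero g)] at this

/-- The functional `χ ↦ (v, χ)`. -/
def pairing (hΩ : bc.Admissible Ω) {v : EuclideanSpace ℝ (Fin d) → ℝ}
    (hv : MemLp v 2 (volume.restrict Ω)) : weakGradients hΩ →ₗ[ℝ] ℝ where
  toFun q := ∫ x in Ω, v x * q.1.1 x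
  map_add' q r := by
    have h1 : Integrable (fun x => v x * q.1.1 x) (volume.restrict Ω) :=
      hv.integrable_mul q.2.memLp
    have h2 : Integrable (fun x => v x * r.1.1 x) (volume.restrict Ω) :=
      hv.integrable_mul r.2.memLp
    simp only [Submodule.coe_add, Prod.fst_add, Pi.add_apply, mul_add]
    exact integral_add h1 h2
  map_smul' c q := by
    simp only [Submodule.coe_smul, Prod.smul_fst, Pi.smul_apply, smul_eq_mul, RingHom.id_apply]
    rw [← integral_const_mul]
    congr 1; ext x; ring

theorem integrable_inner_of_memLp {g h : EuclideanSpace ℝ (Fin d) → EuclideanSpace ℝ (Fin d)}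
    {μ : Measure (EuclideanSpace ℝ (Fin d))} (hg : MemLp g 2 μ) (hh : MemLp h 2 μ) :
    Integrable (fun x => inner ℝ (g x) (h x)) μ := by
  refine (L2.integrable_inner (𝕜 := ℝ) hg.toLp hh.toLp).congr ?_
  filter_upwards [hg.coeFn_toLp, hh.coeFn_toLp] with x hx hx'
  rw [hx, hx']

/-- The form `(∇v, ∇χ)`. -/
def dirichletForm (hΩ : bc.Admissible Ω) :
    weakGradients hΩ →ₗ[ℝ] weakGradients hΩ →ₗ[ℝ] ℝ :=
  have key (q r : weakGradients hΩ) :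
      Integrable (fun x => inner ℝ (q.1.2 x) (r.1.2 x)) (volume.restrict Ω) :=
    integrable_inner_of_memLp q.2.memLp_grad r.2.memLp_grad
  LinearMap.mk₂ ℝ (fun q r => ∫ x in Ω, inner ℝ (q.1.2 x) (r.1.2 x))
    (fun q q' r => by
      simp only [Submodule.coe_add, Prod.snd_add, Pi.add_apply, inner_add_left]
      exact integral_add (key q r) (key q' r))
    (fun c q r => by
      simp only [Submodule.coe_smul, Prod.smul_snd, Pi.smul_apply, inner_smul_left, conj_trivial,
        smul_eq_mul]
      exact integral_const_mul _ _)
    (fun q r r' => by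
      simp only [Submodule.coe_add, Prod.snd_add, Pi.add_apply, inner_add_right]
      exact integral_add (key q r) (key q r'))
    (fun c q r => by
      simp only [Submodule.coe_smul, Prod.smul_snd, Pi.smul_apply, inner_smul_right, smul_eq_mul]
      exact integral_const_mul _ _)

theorem eLpNorm_eq_ofReal_sqrt {g : EuclideanSpace ℝ (Fin d) → EuclideanSpace ℝ (Fin d)}
    (hg : MemLp g 2 (volume.restrict Ω)) : eLpNorm g 2 (volume.restrict Ω) =
      ENNReal.ofReal √(∫ x in Ω, inner ℝ (g x) (g x)) := by
  rw [hg.eLpNorm_eq_integral_rpow_norm two_ne_zero ENNReal.ofNat_ne_top]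
  simp [Real.sqrt_eq_rpow]

theorem integral_inner_self_nonneg (g : EuclideanSpace ℝ (Fin d) → EuclideanSpace ℝ (Fin d)) :
    0 ≤ ∫ x in Ω, inner ℝ (g x) (g x) :=
  integral_nonneg fun _ => real_inner_self_nonneg

theorem hNegOneNorm_le_ofReal_sqrt {v : EuclideanSpace ℝ (Fin d) → ℝ} {Q : ℝ} (hQ : 0 ≤ Q)
    (h : ∀ χ G, IsWeakGradient bc Ω χ G →
      (∫ x in Ω, v x * χ x) ^ 2 ≤ Q * ∫ x in Ω, inner ℝ (G x) (G x)) :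
    hNegOneNorm bc Ω v ≤ ENNReal.ofReal √Q := by
  refine iSup_le fun χ => iSup_le fun G => iSup_le fun hG => ENNReal.div_le_of_le_mul ?_
  rw [eLpNorm_eq_ofReal_sqrt hG.memLp_grad, ← ENNReal.ofReal_mul (by positivity),
    ← Real.sqrt_mul hQ]
  exact ENNReal.ofReal_le_ofReal (Real.abs_le_sqrt (h χ G hG))

/-- Finiteness also covers a vanishing gradient: a nonzero pairing would then make the quotient
infinite. -/
theorem sq_pairing_le_of_hNegOneNorm_ne_top {v : EuclideanSpace ℝ (Fin d) → ℝ}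
    (hv : hNegOneNorm bc Ω v ≠ ⊤) {χ : EuclideanSpace ℝ (Fin d) → ℝ}
    {G : EuclideanSpace ℝ (Fin d) → EuclideanSpace ℝ (Fin d)} (h : IsWeakGradient bc Ω χ G) :
    (∫ x in Ω, v x * χ x) ^ 2 ≤
      (hNegOneNorm bc Ω v).toReal ^ 2 * ∫ x in Ω, inner ℝ (G x) (G x) := by
  have h1 : ENNReal.ofReal |∫ x in Ω, v x * χ x| / eLpNorm G 2 (volume.restrict Ω) ≤
      hNegOneNorm bc Ω v :=
    le_iSup_of_le χ (le_iSup_of_le G (le_iSup_of_le h le_rfl))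
  have h2 : ENNReal.ofReal |∫ x in Ω, v x * χ x| ≤
      hNegOneNorm bc Ω v * eLpNorm G 2 (volume.restrict Ω) := by
    rwa [ENNReal.div_le_iff_le_mul (Or.inr hv) (Or.inl h.memLp_grad.2.ne)] at h1
  have hI := integral_inner_self_nonneg (Ω := Ω) G
  rw [eLpNorm_eq_ofReal_sqrt h.memLp_grad, ← ENNReal.ofReal_toReal hv,
    ← ENNReal.ofReal_mul ENNReal.toReal_nonneg, ENNReal.ofReal_le_ofReal_iff (by positivity)] at h2
  calc (∫ x in Ω, v x * χ x) ^ 2 = |∫ x in Ω, v x * χ x| ^ 2 := (sq_abs _).symm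
    _ ≤ ((hNegOneNorm bc Ω v).toReal * √(∫ x in Ω, inner ℝ (G x) (G x))) ^ 2 := by gcongr
    _ = _ := by rw [mul_pow, Real.sq_sqrt hI]

theorem IsNegLaplacian.memLp {v h : EuclideanSpace ℝ (Fin d) → ℝ} (hA : IsNegLaplacian bc Ω v h) :
    MemLp v 2 (volume.restrict Ω) :=
  hA.2.choose_spec.1.memLp

end EnergySpace

/-! ### One step of the scheme -/

section Step

variable {d : ℕ} {bc : BoundaryCondition} {Ω : Set (EuclideanSpace ℝ (Fin d))}

/-- With `η = (p - 3/2) / α`, the term `m f(v)` absorbs all but `(3/2) c₀ |v|^{2p}` of the coercive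
term `p c₀ |v|^{2p}`, and the remainder is nonnegative. If `α = 0`, then `m = 0` and coercivity
alone suffices. -/
theorem IsNonlinearity.neg_le_sub_mul {p : ℝ} {f F : ℝ → ℝ} {c₀ c₁ : ℝ} {c₂ : ℝ → ℝ} {c₃ : ℝ}
    (hf : IsNonlinearity d p f F c₀ c₁ c₂ c₃) {α m : ℝ} (hm : |m| ≤ α) (v : ℝ) :
    -(c₁ + c₂ ((p - 3 / 2) / α) * α) ≤ (v - m) * f v := by
  have hα : 0 ≤ α := (abs_nonneg m).trans hm
  have hp := hf.two_le
  have hc₀ := hf.c₀_pos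
  have hpow : 0 ≤ c₀ * |v| ^ (2 * p) := by positivity
  have h1 := hf.lower v
  have h2 : m * f v ≤ α * |f v| := by
    calc m * f v ≤ |m * f v| := le_abs_self _
      _ = |m| * |f v| := abs_mul _ _
      _ ≤ α * |f v| := by gcongr
  rcases hα.eq_or_lt with rfl | hα
  · simp only [mul_zero, add_zero, zero_mul] at h2 ⊢
    nlinarith
  · have h3 := hf.growth ((p - 3 / 2) / α) (by apply div_pos <;> linarith) v
    have h4 : α * |f v| ≤ (p - 3 / 2) * (c₀ * |v| ^ (2 * p)) + c₂ ((p - 3 / 2) / α) * α := by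
      calc α * |f v| ≤ α * ((p - 3 / 2) / α * c₀ * |v| ^ (2 * p) + c₂ ((p - 3 / 2) / α)) := by
            gcongr
        _ = _ := by field_simp
    nlinarith

/-- Evaluate at `0`, where `F` vanishes. Hence the term `2 c₃` only enlarges `C₁`. -/
theorem IsNonlinearity.c₃_nonneg {p : ℝ} {f F : ℝ → ℝ} {c₀ c₁ : ℝ} {c₂ : ℝ → ℝ} {c₃ : ℝ}
    (hf : IsNonlinearity d p f F c₀ c₁ c₂ c₃) : 0 ≤ c₃ := by
  have h := hf.primitive_lower 0
  rw [hf.primitive_zero, abs_zero, Real.zero_rpow (by linarith [hf.two_le])] at h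
  linarith

theorem IsNonlinearity.C₁_nonneg {p : ℝ} {f F : ℝ → ℝ} {c₀ c₁ : ℝ} {c₂ : ℝ → ℝ} {c₃ : ℝ}
    (hf : IsNonlinearity d p f F c₀ c₁ c₂ c₃) {α : ℝ} (hα : 0 ≤ α) : 0 ≤ C₁ Ω p c₁ c₂ c₃ α := by
  have h := hf.neg_le_sub_mul (m := 0) (by simpa using hα) 0
  have h3 := hf.c₃_nonneg
  rw [sub_self, zero_mul] at h
  exact mul_nonneg (by linarith) measureReal_nonneg

theorem IsNonlinearity.neg_C₁_le_integral {p : ℝ} {f F : ℝ → ℝ} {c₀ c₁ : ℝ} {c₂ : ℝ → ℝ} {c₃ : ℝ}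
    (hf : IsNonlinearity d p f F c₀ c₁ c₂ c₃) (hΩ : bc.Admissible Ω)
    {u : EuclideanSpace ℝ (Fin d) → ℝ} {α : ℝ} (hm : |mean Ω u| ≤ α)
    (hint : Integrable (fun x => meanFree Ω u x * f (u x)) (volume.restrict Ω)) :
    -C₁ Ω p c₁ c₂ c₃ α ≤ ∫ x in Ω, meanFree Ω u x * f (u x) := by
  have : IsFiniteMeasure (volume.restrict Ω) := ⟨by simpa using hΩ.volume_ne_top.lt_top⟩
  have h3 := hf.c₃_nonneg
  have hV := hΩ.volume_real_pos
  calc -C₁ Ω p c₁ c₂ c₃ α ≤ -(c₁ + c₂ ((p - 3 / 2) / α) * α) * volume.real Ω := by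
        unfold C₁; nlinarith [mul_nonneg h3 hV.le]
    _ = ∫ x in Ω, -(c₁ + c₂ ((p - 3 / 2) / α) * α) := by simp [mul_comm]
    _ ≤ _ := integral_mono (integrable_const _) hint fun x => hf.neg_le_sub_mul hm (u x)

/-- Test with the constant `1`, whose gradient is zero. -/
theorem IsNegLaplacian.mean_eq {w u₀ u₁ : EuclideanSpace ℝ (Fin d) → ℝ} {k : ℝ} (hk : 0 < k)
    (hd : 1 ≤ d) (hΩ : bc.Admissible Ω) (hu₀ : MemLp u₀ 2 (volume.restrict Ω))
    (hu₁ : MemLp u₁ 2 (volume.restrict Ω))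
    (hw : IsNegLaplacian bc Ω w (fun x => -((u₁ x - u₀ x) / k))) : mean Ω u₁ = mean Ω u₀ := by
  have : IsFiniteMeasure (volume.restrict Ω) := ⟨by simpa using hΩ.volume_ne_top.lt_top⟩
  obtain ⟨-, g, -, hg⟩ := hw
  have h := hg _ _ (isWeakGradient_const hd hΩ 1)
  simp only [inner_zero_right, integral_zero, mul_one, integral_neg, integral_div] at h
  rw [integral_sub (hu₁.integrable one_le_two) (hu₀.integrable one_le_two)] at h
  have h' : (∫ x in Ω, u₁ x) = ∫ x in Ω, u₀ x := by
    field_simp at h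
    linarith
  rw [mean, mean, h']

theorem euler_step_hNegOneNorm {p : ℝ} {f F : ℝ → ℝ} {c₀ c₁ : ℝ} {c₂ : ℝ → ℝ} {c₃ : ℝ}
    (hf : IsNonlinearity d p f F c₀ c₁ c₂ c₃) (hd : 1 ≤ d) (hΩ : bc.Admissible Ω) {γ ε k α : ℝ}
    (hγ : IsNegOneConstant bc Ω γ) (hε : 0 < ε) (hk : 0 < k)
    {u₀ u₁ a w : EuclideanSpace ℝ (Fin d) → ℝ} (hu₀ : MemLp u₀ 2 (volume.restrict Ω))
    (hm : |mean Ω u₀| ≤ α) (hfin : hNegOneNorm bc Ω (meanFree Ω u₀) ≠ ⊤)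
    (ha : IsNegLaplacian bc Ω u₁ a)
    (hwa : ∀ᵐ x ∂volume.restrict Ω, w x = ε * a x + f (u₁ x))
    (hw : IsNegLaplacian bc Ω w (fun x => -((u₁ x - u₀ x) / k))) :
    hNegOneNorm bc Ω (meanFree Ω u₁) ≠ ⊤ ∧
    (hNegOneNorm bc Ω (meanFree Ω u₁)).toReal ^ 2 * (1 + 2 * k / (γ ^ 2 / ε)) ≤
      (hNegOneNorm bc Ω (meanFree Ω u₀)).toReal ^ 2 + 2 * k * C₁ Ω p c₁ c₂ c₃ α := by
  have : IsFiniteMeasure (volume.restrict Ω) := ⟨by simpa using hΩ.volume_ne_top.lt_top⟩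
  have hu₁ := ha.memLp
  have hwm := hw.memLp
  have hmean := hw.mean_eq hk hd hΩ hu₀ hu₁
  obtain ⟨ham, g, hg, hgeq⟩ := ha
  obtain ⟨-, gw, hgw, hgweq⟩ := hw
  have hU₀ : MemLp (meanFree Ω u₀) 2 (volume.restrict Ω) := hu₀.sub (memLp_const _)
  have hU₁ : MemLp (meanFree Ω u₁) 2 (volume.restrict Ω) := hu₁.sub (memLp_const _)
  obtain ⟨hγ0, hγ⟩ := hγ
  have hγg := hγ u₁ g hg
  have hG := integral_inner_self_nonneg (Ω := Ω) g
  set G := ∫ x in Ω, inner ℝ (g x) (g x) with hGdef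
  rw [eLpNorm_eq_ofReal_sqrt hg.memLp_grad, ← ENNReal.ofReal_mul hγ0.le] at hγg
  have hfin₁ : hNegOneNorm bc Ω (meanFree Ω u₁) ≠ ⊤ := ne_top_of_le_ne_top ENNReal.ofReal_ne_top hγg
  refine ⟨hfin₁, ?_⟩
  have hy₁ : (hNegOneNorm bc Ω (meanFree Ω u₁)).toReal ^ 2 ≤ γ ^ 2 * G := by
    have h1 : (hNegOneNorm bc Ω (meanFree Ω u₁)).toReal ≤ γ * √G :=
      ENNReal.toReal_le_of_le_ofReal (by positivity) hγg
    calc _ ≤ (γ * √G) ^ 2 := by gcongr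
      _ = _ := by rw [mul_pow, Real.sq_sqrt hG]
  obtain ⟨hR, hdual⟩ := dual_sq_le_sub (pairing hΩ hU₀) (pairing hΩ hU₁) (dirichletForm hΩ)
    (k := k) (Q := (hNegOneNorm bc Ω (meanFree Ω u₀)).toReal ^ 2)
    (M := (hNegOneNorm bc Ω (meanFree Ω u₁)).toReal ^ 2)
    (fun q r => integral_congr_ae (ae_of_all _ fun x => real_inner_comm _ _))
    (fun q => integral_inner_self_nonneg _) hk.le (by positivity) (by positivity) ⟨(w, gw), hgw⟩
    (fun χ => by
      change (∫ x in Ω, meanFree Ω u₁ x * χ.1.1 x) - (∫ x in Ω, meanFree Ω u₀ x * χ.1.1 x) =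
        -k * ∫ x in Ω, inner ℝ (gw x) (χ.1.2 x)
      have i1 : Integrable (fun x => meanFree Ω u₁ x * χ.1.1 x) (volume.restrict Ω) :=
        hU₁.integrable_mul χ.2.memLp
      have i0 : Integrable (fun x => meanFree Ω u₀ x * χ.1.1 x) (volume.restrict Ω) :=
        hU₀.integrable_mul χ.2.memLp
      rw [hgweq _ _ χ.2, ← integral_sub i1 i0, ← integral_const_mul]
      congr 1
      ext x
      simp only [meanFree, hmean]
      field_simp
      ring)
    (fun χ => sq_pairing_le_of_hNegOneNorm_ne_top hfin χ.2)
    (fun χ => sq_pairing_le_of_hNegOneNorm_ne_top hfin₁ χ.2)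
  have hnorm := hNegOneNorm_le_ofReal_sqrt (bc := bc) hR fun χ G hG => hdual ⟨(χ, G), hG⟩
  have hy := ENNReal.toReal_le_of_le_ofReal (Real.sqrt_nonneg _) hnorm
  have hy' := (Real.le_sqrt ENNReal.toReal_nonneg hR).1 hy
  change _ ≤ _ - 2 * k * ∫ x in Ω, meanFree Ω u₁ x * w x at hy'
  -- No growth bound is needed for `f(u₁) ∈ L²`: it equals `w - ε a` almost everywhere.
  have hfm : MemLp (fun x => f (u₁ x)) 2 (volume.restrict Ω) :=
    (hwm.sub (ham.const_mul ε)).ae_eq (hwa.mono fun x hx => by simp [hx])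
  have hif : Integrable (fun x => meanFree Ω u₁ x * f (u₁ x)) (volume.restrict Ω) :=
    hU₁.integrable_mul hfm
  have hia : Integrable (fun x => a x * meanFree Ω u₁ x) (volume.restrict Ω) :=
    ham.integrable_mul hU₁
  have hia' : Integrable (fun x => ε * (a x * (u₁ x - mean Ω u₁))) (volume.restrict Ω) :=
    hia.const_mul ε
  -- The weak equation for `a` is tested with `u₁ - m(u₁)`, which has the same gradient as `u₁`.
  have hpair : ∫ x in Ω, meanFree Ω u₁ x * w x =
      ε * G + ∫ x in Ω, meanFree Ω u₁ x * f (u₁ x) := by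
    rw [hGdef, hgeq _ _ (hg.sub_const hd hΩ (mean Ω u₁)), ← integral_const_mul,
      ← integral_add hia' hif]
    refine integral_congr_ae (hwa.mono fun x hx => ?_)
    simp only [hx, meanFree]
    ring
  have hlow := hf.neg_C₁_le_integral hΩ (u := u₁) (α := α) (by rwa [hmean]) hif
  have hyG : (hNegOneNorm bc Ω (meanFree Ω u₁)).toReal ^ 2 * (2 * k / (γ ^ 2 / ε)) ≤
      2 * k * (ε * G) := by
    calc _ ≤ γ ^ 2 * G * (2 * k / (γ ^ 2 / ε)) := by gcongr
      _ = _ := by field_simp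
  rw [hpair] at hy'
  nlinarith

end Step

end CahnHilliard

end

/-! ### The uniform bound and the absorbing ball -/

theorem mainTheorem5 {d : ℕ} (hd : 1 ≤ d) (hd3 : d ≤ 3) (bc : CahnHilliard.BoundaryCondition)
    (Ω : Set (EuclideanSpace ℝ (Fin d))) (hΩ : bc.Admissible Ω) :
    (∃ γ₁ : ℝ, CahnHilliard.IsNegOneConstant bc Ω γ₁) ∧
    ∀ γ₁ : ℝ, CahnHilliard.IsNegOneConstant bc Ω γ₁ →
    ∀ (p : ℝ) (f F : ℝ → ℝ) (c₀ c₁ : ℝ) (c₂ : ℝ → ℝ) (c₃ : ℝ),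
    CahnHilliard.IsNonlinearity d p f F c₀ c₁ c₂ c₃ →
    ∀ ε c α R : ℝ, 0 < ε → 0 < c → 0 ≤ R →
    ∀ (t : ℕ → ℝ) (k : ℝ), CahnHilliard.IsTimeGrid t →
    IsLUB (Set.range fun n => t (n + 1) - t n) k → k ≤ 8 * ε / c ^ 2 →
    ∀ u : ℕ → EuclideanSpace ℝ (Fin d) → ℝ,
    CahnHilliard.IsImplicitEuler bc Ω ε f t u →
    CahnHilliard.hNegOneNorm bc Ω (CahnHilliard.meanFree Ω (u 0)) ≤ ENNReal.ofReal R →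
    |CahnHilliard.mean Ω (u 0)| ≤ α →
    (∀ n, CahnHilliard.hNegOneNorm bc Ω (CahnHilliard.meanFree Ω (u n)) ≤
      ENNReal.ofReal (max R (CahnHilliard.rhoHat Ω p c₁ c₂ c₃ c ε γ₁ α))) ∧
    (0 < CahnHilliard.rhoHat Ω p c₁ c₂ c₃ c ε γ₁ α →
      (∃ n₀ : ℕ, 1 ≤ n₀ ∧ (γ₁ ^ 2 / ε + 8 * ε / c ^ 2) *
        Real.log (R ^ 2 / CahnHilliard.rhoHat Ω p c₁ c₂ c₃ c ε γ₁ α ^ 2) ≤ t n₀) ∧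
      ∀ n₀ : ℕ, (γ₁ ^ 2 / ε + 8 * ε / c ^ 2) *
        Real.log (R ^ 2 / CahnHilliard.rhoHat Ω p c₁ c₂ c₃ c ε γ₁ α ^ 2) ≤ t n₀ →
      ∀ n, n₀ ≤ n → CahnHilliard.hNegOneNorm bc Ω (CahnHilliard.meanFree Ω (u n)) ≤
        ENNReal.ofReal (2 * CahnHilliard.rhoHat Ω p c₁ c₂ c₃ c ε γ₁ α)) := by
  refine ⟨CahnHilliard.exists_isNegOneConstant hΩ, ?_⟩
  intro γ₁ hγ p f F c₀ c₁ c₂ c₃ hf ε c α R hε hc hR t k ht hk hkK u hu hu0 hα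
  obtain ⟨hu0m, hstep⟩ := hu
  have hα0 : 0 ≤ α := (abs_nonneg _).trans hα
  have hdt : ∀ n, 0 < t (n + 1) - t n := fun n => sub_pos.2 (ht.strictMono n.lt_succ_self)
  have hdtK : ∀ n, t (n + 1) - t n ≤ 8 * ε / c ^ 2 := fun n => (hk.1 ⟨n, rfl⟩).trans hkK
  have hmem : ∀ n, MemLp (u n) 2 (volume.restrict Ω) := fun n => by
    cases n with
    | zero => exact hu0m
    | succ n =>
      obtain ⟨a, w, ha, -⟩ := hstep n
      exact ha.memLp
  have hmean : ∀ n, CahnHilliard.mean Ω (u n) = CahnHilliard.mean Ω (u 0) := fun n => by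
    induction n with
    | zero => rfl
    | succ n ih =>
      obtain ⟨a, w, -, -, hw⟩ := hstep n
      exact (hw.mean_eq (hdt n) hd hΩ (hmem n) (hmem (n + 1))).trans ih
  have hone : ∀ n, CahnHilliard.hNegOneNorm bc Ω (CahnHilliard.meanFree Ω (u n)) ≠ ⊤ →
      CahnHilliard.hNegOneNorm bc Ω (CahnHilliard.meanFree Ω (u (n + 1))) ≠ ⊤ ∧ _ :=
    fun n hn => by
      obtain ⟨a, w, ha, hwa, hw⟩ := hstep n
      exact CahnHilliard.euler_step_hNegOneNorm hf hd hΩ hγ hε (hdt n) (hmem n)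
        (α := α) (by rwa [hmean]) hn ha hwa hw
  have hfin : ∀ n, CahnHilliard.hNegOneNorm bc Ω (CahnHilliard.meanFree Ω (u n)) ≠ ⊤ := fun n => by
    induction n with
    | zero => exact ne_top_of_le_ne_top ENNReal.ofReal_ne_top hu0
    | succ n ih => exact (hone n ih).1
  set y : ℕ → ℝ := fun n =>
    (CahnHilliard.hNegOneNorm bc Ω (CahnHilliard.meanFree Ω (u n))).toReal ^ 2 with hy
  have hrec : ∀ n, y (n + 1) * (1 + 2 * (t (n + 1) - t n) / (γ₁ ^ 2 / ε)) ≤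
      y n + 2 * (t (n + 1) - t n) * CahnHilliard.C₁ Ω p c₁ c₂ c₃ α := fun n => (hone n (hfin n)).2
  have hC := hf.C₁_nonneg (Ω := Ω) hα0
  have hγ0 := hγ.1
  have hg : 0 < γ₁ ^ 2 / ε := by positivity
  have hK : 0 < 8 * ε / c ^ 2 := by positivity
  have hρ0 : 0 ≤ CahnHilliard.rhoHat Ω p c₁ c₂ c₃ c ε γ₁ α := by
    unfold CahnHilliard.rhoHat; positivity
  have hρsq : CahnHilliard.rhoHat Ω p c₁ c₂ c₃ c ε γ₁ α ^ 2 =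
      2 * CahnHilliard.C₁ Ω p c₁ c₂ c₃ α * (γ₁ ^ 2 / ε + 8 * ε / c ^ 2) := by
    unfold CahnHilliard.rhoHat
    rw [mul_pow, Real.sq_sqrt (by positivity), Real.sq_sqrt (by positivity)]
  set ρ := CahnHilliard.rhoHat Ω p c₁ c₂ c₃ c ε γ₁ α
  set C := CahnHilliard.C₁ Ω p c₁ c₂ c₃ α
  set g := γ₁ ^ 2 / ε
  set K := 8 * ε / c ^ 2
  have hCg : C * g ≤ ρ ^ 2 := by
    rw [hρsq]
    nlinarith [mul_nonneg hC hg.le, mul_nonneg hC hK.le]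
  have hy0 : y 0 ≤ R ^ 2 := by
    have := ENNReal.toReal_le_of_le_ofReal hR hu0
    simp only [hy]
    gcongr
  have hback : ∀ n (r : ℝ), 0 ≤ r → y n ≤ r ^ 2 →
      CahnHilliard.hNegOneNorm bc Ω (CahnHilliard.meanFree Ω (u n)) ≤ ENNReal.ofReal r := by
    intro n r hr h
    rw [← ENNReal.ofReal_toReal (hfin n)]
    exact ENNReal.ofReal_le_ofReal (le_of_sq_le_sq h hr)
  refine ⟨fun n => hback n _ (le_max_of_le_left hR) ?_, fun hρ => ⟨?_, ?_⟩⟩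
  · refine CahnHilliard.le_of_euler_recursion hg (fun n => (hdt n).le) hrec (hy0.trans ?_)
      (hCg.trans ?_) n
    · gcongr; exact le_max_left _ _
    · gcongr; exact le_max_right _ _
  · obtain ⟨n, hn, hn'⟩ := ((ht.tendsto.eventually_ge_atTop _).and (eventually_ge_atTop 1)).exists
    exact ⟨n, hn', hn⟩
  · intro n₀ hn₀ n hn
    refine hback n _ (by positivity) ?_
    have h1 := CahnHilliard.le_exp_of_euler_recursion hg ht.zero (fun n => (hdt n).le) hdtK hrec
      (sq_nonneg R) hC hy0 n
    have h2 : R ^ 2 * Real.exp (-(t n / (g + K))) ≤ ρ ^ 2 := by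
      -- For `R = 0` the decaying term vanishes, so the logarithm plays no role.
      rcases hR.eq_or_lt with rfl | hR
      · simp; positivity
      have h3 : Real.log (R ^ 2 / ρ ^ 2) ≤ t n / (g + K) := by
        rw [le_div_iff₀' (by positivity)]
        exact hn₀.trans (ht.strictMono.monotone hn)
      calc R ^ 2 * Real.exp (-(t n / (g + K))) ≤ R ^ 2 * Real.exp (-Real.log (R ^ 2 / ρ ^ 2)) := by
            gcongr
        _ = ρ ^ 2 := by
            rw [Real.exp_neg, Real.exp_log (by positivity)]
            field_simp
    -- `C g ≤ ρ²` and the decayed term is at most `ρ²`, so `y n ≤ 2 ρ² ≤ (2 ρ)²`.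
    nlinarith
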